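/- **Setting.** Let $f_1,f_2:\mathbb{R}^n\times\mathbb{R}_{\ge0}\to\mathbb{R}^n$ be continuous and, for $\varepsilon>0$, consider the system $$\dot x=f_\varepsilon(x,\tau):=\varepsilon^{-1}f_1(x,\tau)+f_2(x,\tau),\qquad \dot\tau=\varepsilon^{-2},\qquad (x,\tau)\in\mathbb{R}^n\times\mathbb{R}_{\ge0}.\tag{S}$$ A solution of (S) from $(x_0,\tau_0)\in\mathbb{R}^n\times\mathbb{R}_{\ge0}$ is a $C^1$ function $(x,\tau):[0,t_s)\to\mathbb{R}^n\times\mathbb{R}_{\ge0}$, $0<t_s\le\infty$, with $(x(0),\tau(0))=(x_0,\tau_0)$ that satisfies (S) on $[0,t_s)$; it is complete if $t_s=\infty$. Class $\mathcal K$: continuous strictly increasing $\alpha:\mathbb{R}_{\ge0}\to\mathbb{R}_{\ge0}$ with $\alpha(0)=0$; class $\mathcal K_\infty$: moreover $\alpha(r)\to\infty$ as $r\to\infty$; class $\mathcal{KL}$: continuous $\beta:\mathbb{R}_{\ge0}^2\to\mathbb{R}_{\ge0}$ with $\beta(\cdot,s)\in\mathcal K_\infty$ for every $s\ge0$, with $\beta(r,\cdot)$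 strictly decreasing for every $r>0$, and with $\beta(r,s)\to0$ as $s\to\infty$ for every $r\ge0$. A function $\phi:\mathbb{R}^n\to\mathbb{R}_{\ge0}$ is called positive definite if $\phi(0)=0$ and there is $\alpha\in\mathcal K$ with $\alpha(|x|)\le\phi(x)$ for all $x\in\mathbb{R}^n$. The origin is *uniformly globally practically asymptotically stable* (UGpAS) for (S) if there is $\beta\in\mathcal{KL}$ such that for every $\nu>0$ there is $\varepsilon^*>0$ such that for all $\varepsilon\in(0,\varepsilon^*)$ and all $(x_0,\tau_0)\in\mathbb{R}^n\times\mathbb{R}_{\ge0}$, every solution of (S) from $(x_0,\tau_0)$ satisfies $|x(t)|\le\beta(|x_0|,t)+\nu$ at all times $t\ge0$ of its domain, and every maximal (non-extendable) solution is complete. **Regularity assumption with $\delta_1=0$.** There are constants $L_1,L_2,L_3,T>0$ such that for $k\in\{1,2\}$, all $x_1,x_2,x\in\mathbb{R}^n$ and all $\tau,\tau_1,\tau_2\ge0$: $|f_k(x_1,\tau)-f_k(x_2,\tau)|\le L_k|x_1-x_2|$; $f_k(x,\tau+T)=f_k(x,\tau)$ and $\int_0^Tf_1(x,\tau)\,d\tau=0$;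 $f_k(\cdot,\tau)$ is $C^{3-k}$ on $\mathbb{R}^n$; and $|D_xf_1(x_1,\tau_1)f_1(x_1,\tau_2)-D_xf_1(x_2,\tau_1)f_1(x_2,\tau_2)|\le L_3|x_1-x_2|$. **Constructions.** For $\epsilon>0$ call $\delta=(\delta_1,\delta_2,\delta_3)$ admissible if $\delta_1\ge0$, $\delta_2\ge(1+\epsilon)\delta_1$ and $\delta_3>(1+\epsilon)\delta_2$; here always $\delta_1=0$. Let $\chi_1(r)=e^{-1/r}$ for $r>0$, $\chi_1(r)=0$ for $r\le0$, $\chi_2(r)=\chi_1(r)/(\chi_1(r)+\chi_1(1-r))$, $\varphi(x)=\chi_2\big(\tfrac{|x|-\delta_1}{\delta_2-\delta_1}\big)$ if $\delta_2>\delta_1$ and $\varphi\equiv1$ if $\delta_2=\delta_1=0$, and $\hat f_k=\varphi f_k$. With $[a,b]=D_xb\,a-D_xa\,b$, put $$v_1(x,\tau)=\int_0^\tau\hat f_1(x,s)\,ds,\qquad \bar f(x)=\frac1{2T}\int_0^T\big(2\hat f_2(x,\tau)+[v_1,\hat f_1](x,\tau)\big)\,d\tau,$$ $$v_2(x,\tau)=\int_0^\tau\big(\hat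 f_2(x,s)+D_x\hat f_1(x,s)v_1(x,s)-\bar f(x)\big)\,ds-D_xv_1(x,\tau)v_1(x,\tau),$$ $\Phi(x,\tau)=x-\varepsilon v_1(x,\tau)-\varepsilon^2v_2(x,\tau)$ and $\Psi(x,\tau)=(\Phi(x,\tau),\tau)$. Where $\Psi$ is a bijection of $\mathbb{R}^n\times\mathbb{R}_{\ge0}$ (which is the case for all small $\varepsilon>0$), let $$\Psi_*f_\varepsilon=(D_x\Phi\circ\Psi^{-1})\,(f_\varepsilon\circ\Psi^{-1})+\varepsilon^{-2}\,D_\tau\Phi\circ\Psi^{-1},\qquad g(x,\tau,\varepsilon)=\varepsilon^{-1}\big(\Psi_*f_\varepsilon(x,\tau)-\bar f(x)\big).$$ **Lyapunov assumption for $\delta$, $V$, $\phi$.** $V:\mathbb{R}^n\to\mathbb{R}_{\ge0}$ is $C^1$, $\phi:\mathbb{R}^n\to\mathbb{R}_{\ge0}$ is positive definite, and there are $\alpha_1,\alpha_2\in\mathcal K_\infty$ and $c_1,c_2>0$ such that (a) $\alpha_1(|x|)\le V(x)\le\alpha_2(|x|)$ and $|\nabla V(x)|\le c_2\phi(x)$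 for all $x\in\mathbb{R}^n$; (b) $\langle\nabla V(x),\bar f(x)\rangle\le-c_1\phi(x)^2$ whenever $|x|\ge\delta_3$; (c) at least one of the following holds: (i) there are $\varepsilon_0>0$ and $\bar L_g>0$ with $|g(x,\tau,\varepsilon)|\le\bar L_g(\phi(x)+1)$ whenever $|x|\ge\delta_3$, $\tau\ge0$ and $0<\varepsilon\le\varepsilon_0$; (ii) there is $\alpha_3\in\mathcal K$ with $\alpha_3(|x|)\,|x|\le\phi(x)$ for all $x\in\mathbb{R}^n$. **Corollary 3.** Suppose that the regularity assumption holds with $\delta_1=0$, and that there are functions $V$ and $\phi$ such that the Lyapunov assumption for $\delta$, $V$, $\phi$ holds for all $\epsilon>0$ and all admissible $\delta=(0,\delta_2,\delta_3)$. Then the origin is UGpAS for (S). -/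

import Mathlib

open Set Filter Topology

noncomputable section

namespace OscAvg

/-! ### Comparison functions -/

/-- Class `K`: continuous, strictly increasing on `[0, ∞)`, vanishing at `0`. -/
structure IsClassK (α : ℝ → ℝ) : Prop where
  continuousOn : ContinuousOn α (Ici 0)
  strictMonoOn : StrictMonoOn α (Ici 0)
  zero : α 0 = 0

/-- Class `K∞`: class `K` and unbounded. -/
structure IsClassKInf (α : ℝ → ℝ) : Prop extends IsClassK α where
  tendsto_atTop : Tendsto α atTop atTop

/-- Class `KL`: jointly continuous on `[0, ∞) × [0, ∞)`, of class `K∞` in the first argument,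
and decreasing to `0` in the second one (strictly if `r > 0`; for `r = 0` it is constantly `0`,
because `β 0 s = 0`). -/
structure IsClassKL (β : ℝ → ℝ → ℝ) : Prop where
  continuousOn : ContinuousOn (fun p : ℝ × ℝ => β p.1 p.2) (Ici 0 ×ˢ Ici 0)
  classKInf : ∀ s, 0 ≤ s → IsClassKInf (fun r => β r s)
  strictAntiOn : ∀ r, 0 < r → StrictAntiOn (β r) (Ici 0)
  tendsto_zero : ∀ r, 0 ≤ r → Tendsto (β r) atTop (𝓝 0)

/-- Positive definite functions on `ℝⁿ`: zero at the origin and bounded from below, on all of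
`ℝⁿ`, by a class `K` function of the norm. -/
structure IsPosDefFun {n : ℕ} (φ : EuclideanSpace ℝ (Fin n) → ℝ) : Prop where
  zero : φ 0 = 0
  lower : ∃ α : ℝ → ℝ, IsClassK α ∧ ∀ x, α ‖x‖ ≤ φ x

/-! ### Solutions and stability

A system `x' = f x τ`, `τ' = ε⁻²` on `ℝⁿ × [0, ∞)`; the values of `f` at `τ < 0` are never used. -/

/-- The interval `[0, tₛ)`, where `tₛ` may be `∞`. -/
def lifeSpan (ts : EReal) : Set ℝ := {t : ℝ | 0 ≤ t ∧ (t : EReal) < ts}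

/-- `(x, τ)` is a solution on `[0, tₛ)`, `0 < tₛ ≤ ∞`, of `x' = f x τ`, `τ' = ε⁻²` from the initial
condition `(x₀, τ₀)`. Only the values of `x` and `τ` on `[0, tₛ)` matter. -/
structure IsSolution {n : ℕ}
    (f : EuclideanSpace ℝ (Fin n) → ℝ → EuclideanSpace ℝ (Fin n)) (ε : ℝ)
    (x₀ : EuclideanSpace ℝ (Fin n)) (τ₀ : ℝ) (ts : EReal)
    (x : ℝ → EuclideanSpace ℝ (Fin n)) (τ : ℝ → ℝ) : Prop where
  pos : 0 < ts
  init_x : x 0 = x₀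
  init_τ : τ 0 = τ₀
  τ_nonneg : ∀ t ∈ lifeSpan ts, 0 ≤ τ t
  contDiffOn_x : ContDiffOn ℝ 1 x (lifeSpan ts)
  contDiffOn_τ : ContDiffOn ℝ 1 τ (lifeSpan ts)
  deriv_x : ∀ t ∈ lifeSpan ts, HasDerivWithinAt x (f (x t) (τ t)) (lifeSpan ts) t
  deriv_τ : ∀ t ∈ lifeSpan ts, HasDerivWithinAt τ ((ε ^ 2)⁻¹) (lifeSpan ts) t

/-- A solution that has no proper extension to a solution on a longer interval. -/
def IsMaximalSolution {n : ℕ}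
    (f : EuclideanSpace ℝ (Fin n) → ℝ → EuclideanSpace ℝ (Fin n)) (ε : ℝ)
    (x₀ : EuclideanSpace ℝ (Fin n)) (τ₀ : ℝ) (ts : EReal)
    (x : ℝ → EuclideanSpace ℝ (Fin n)) (τ : ℝ → ℝ) : Prop :=
  IsSolution f ε x₀ τ₀ ts x τ ∧
    ∀ (ts' : EReal) (x' : ℝ → EuclideanSpace ℝ (Fin n)) (τ' : ℝ → ℝ),
      IsSolution f ε x₀ τ₀ ts' x' τ' → ts ≤ ts' →
      (∀ t ∈ lifeSpan ts, x' t = x t ∧ τ' t = τ t) → ts' = ts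

/-- Uniform global practical asymptotic stability of the origin for the family of systems
`x' = F ε x τ`, `τ' = ε⁻²`. The bound is imposed on every solution, at all times of its interval of
existence, and every solution that cannot be extended is complete; so the bound holds for all
`t ≥ 0` along every maximal solution. -/
def IsUGpAS {n : ℕ}
    (F : ℝ → EuclideanSpace ℝ (Fin n) → ℝ → EuclideanSpace ℝ (Fin n)) : Prop :=
  ∃ β : ℝ → ℝ → ℝ, IsClassKL β ∧
    ∀ ν : ℝ, 0 < ν → ∃ εstar : ℝ, 0 < εstar ∧
      ∀ ε : ℝ, 0 < ε → ε < εstar →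
        ∀ (x₀ : EuclideanSpace ℝ (Fin n)) (τ₀ : ℝ), 0 ≤ τ₀ →
          ∀ (ts : EReal) (x : ℝ → EuclideanSpace ℝ (Fin n)) (τ : ℝ → ℝ),
            IsSolution (F ε) ε x₀ τ₀ ts x τ →
              (∀ t ∈ lifeSpan ts, ‖x t‖ ≤ β ‖x₀‖ t + ν) ∧
              (IsMaximalSolution (F ε) ε x₀ τ₀ ts x τ → ts = ⊤)

/-! ### The oscillatory system and the regularity assumption -/

/-- `f_ε(x, τ) = ε⁻¹ f₁(x, τ) + f₂(x, τ)`. -/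
def oscField {n : ℕ} (f₁ f₂ : EuclideanSpace ℝ (Fin n) → ℝ → EuclideanSpace ℝ (Fin n))
    (ε : ℝ) (x : EuclideanSpace ℝ (Fin n)) (τ : ℝ) : EuclideanSpace ℝ (Fin n) :=
  ε⁻¹ • f₁ x τ + f₂ x τ

/-- `h` is of class `C^k` on the closed set `K`: it is so on an open neighbourhood of `K`. -/
def ContDiffOnClosed {n : ℕ} (k : ℕ) (h : EuclideanSpace ℝ (Fin n) → EuclideanSpace ℝ (Fin n))
    (K : Set (EuclideanSpace ℝ (Fin n))) : Prop :=
  ∃ U, IsOpen U ∧ K ⊆ U ∧ ContDiffOn ℝ k h U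

/-- The regularity assumption for a given `δ₁ ≥ 0`, with period `T`. -/
structure RegularityAssumption {n : ℕ}
    (f₁ f₂ : EuclideanSpace ℝ (Fin n) → ℝ → EuclideanSpace ℝ (Fin n)) (δ₁ T : ℝ) : Prop where
  δ₁_nonneg : 0 ≤ δ₁
  continuousOn₁ : ContinuousOn (fun p : EuclideanSpace ℝ (Fin n) × ℝ => f₁ p.1 p.2)
    (univ ×ˢ Ici 0)
  continuousOn₂ : ContinuousOn (fun p : EuclideanSpace ℝ (Fin n) × ℝ => f₂ p.1 p.2)
    (univ ×ˢ Ici 0)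
  lipschitz₁ : ∃ L : ℝ, 0 < L ∧ ∀ x₁ x₂, δ₁ ≤ ‖x₁‖ → δ₁ ≤ ‖x₂‖ → ∀ τ, 0 ≤ τ →
    ‖f₁ x₁ τ - f₁ x₂ τ‖ ≤ L * ‖x₁ - x₂‖
  lipschitz₂ : ∃ L : ℝ, 0 < L ∧ ∀ x₁ x₂, δ₁ ≤ ‖x₁‖ → δ₁ ≤ ‖x₂‖ → ∀ τ, 0 ≤ τ →
    ‖f₂ x₁ τ - f₂ x₂ τ‖ ≤ L * ‖x₁ - x₂‖
  period_pos : 0 < T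
  periodic₁ : ∀ x τ, 0 ≤ τ → f₁ x (τ + T) = f₁ x τ
  periodic₂ : ∀ x τ, 0 ≤ τ → f₂ x (τ + T) = f₂ x τ
  integral_eq_zero : ∀ x, ∫ τ in (0 : ℝ)..T, f₁ x τ = 0
  contDiff₁ : ∀ τ, 0 ≤ τ → ContDiffOnClosed 2 (fun x => f₁ x τ) {x | δ₁ ≤ ‖x‖}
  contDiff₂ : ∀ τ, 0 ≤ τ → ContDiffOnClosed 1 (fun x => f₂ x τ) {x | δ₁ ≤ ‖x‖}
  lipschitz₃ : ∃ L : ℝ, 0 < L ∧ ∀ x₁ x₂, δ₁ ≤ ‖x₁‖ → δ₁ ≤ ‖x₂‖ →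
    ∀ τ₁ τ₂, 0 ≤ τ₁ → 0 ≤ τ₂ →
      ‖fderiv ℝ (fun x => f₁ x τ₁) x₁ (f₁ x₁ τ₂) - fderiv ℝ (fun x => f₁ x τ₁) x₂ (f₁ x₂ τ₂)‖
        ≤ L * ‖x₁ - x₂‖

/-! ### Near-identity transformation and second-order average -/

/-- The constraints on `δ = (δ₁, δ₂, δ₃)` for a given `ϵ`. -/
structure AdmissibleDelta (ϵ δ₁ δ₂ δ₃ : ℝ) : Prop where
  one : 0 ≤ δ₁
  two : (1 + ϵ) * δ₁ ≤ δ₂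
  three : (1 + ϵ) * δ₂ < δ₃

/-- The smooth reverse bump function; `Real.smoothTransition r` is
`χ₁ r / (χ₁ r + χ₁ (1 - r))` with `χ₁ r = exp (-1 / r)` for `r > 0` and `χ₁ r = 0` for `r ≤ 0`. -/
def bump {n : ℕ} (δ₁ δ₂ : ℝ) (x : EuclideanSpace ℝ (Fin n)) : ℝ :=
  if δ₁ < δ₂ then Real.smoothTransition ((‖x‖ - δ₁) / (δ₂ - δ₁)) else 1

/-- `f̂(x, τ) = bump(x) f(x, τ)`. -/
def cutoff {n : ℕ} (δ₁ δ₂ : ℝ) (f : EuclideanSpace ℝ (Fin n) → ℝ → EuclideanSpace ℝ (Fin n))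
    (x : EuclideanSpace ℝ (Fin n)) (τ : ℝ) : EuclideanSpace ℝ (Fin n) :=
  bump δ₁ δ₂ x • f x τ

/-- The Jacobian `D_x h(x, τ)` with respect to the first argument. -/
def jac {n : ℕ} (h : EuclideanSpace ℝ (Fin n) → ℝ → EuclideanSpace ℝ (Fin n))
    (x : EuclideanSpace ℝ (Fin n)) (τ : ℝ) :
    EuclideanSpace ℝ (Fin n) →L[ℝ] EuclideanSpace ℝ (Fin n) :=
  fderiv ℝ (fun y => h y τ) x

/-- `v₁(x, τ) = ∫₀^τ g₁(x, s) ds`. -/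
def v₁ {n : ℕ} (g₁ : EuclideanSpace ℝ (Fin n) → ℝ → EuclideanSpace ℝ (Fin n))
    (x : EuclideanSpace ℝ (Fin n)) (τ : ℝ) : EuclideanSpace ℝ (Fin n) :=
  ∫ s in (0 : ℝ)..τ, g₁ x s

/-- The Lie bracket `[a, b] = D_x b · a - D_x a · b` in the first argument. -/
def bracket {n : ℕ} (a b : EuclideanSpace ℝ (Fin n) → ℝ → EuclideanSpace ℝ (Fin n))
    (x : EuclideanSpace ℝ (Fin n)) (τ : ℝ) : EuclideanSpace ℝ (Fin n) :=
  jac b x τ (a x τ) - jac a x τ (b x τ)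

/-- The second-order average `(2T)⁻¹ ∫₀^T (2 g₂ + [v₁, g₁]) dτ` of `(g₁, g₂)`. -/
def avgOf {n : ℕ} (g₁ g₂ : EuclideanSpace ℝ (Fin n) → ℝ → EuclideanSpace ℝ (Fin n)) (T : ℝ)
    (x : EuclideanSpace ℝ (Fin n)) : EuclideanSpace ℝ (Fin n) :=
  (2 * T)⁻¹ • ∫ τ in (0 : ℝ)..T, ((2 : ℝ) • g₂ x τ + bracket (v₁ g₁) g₁ x τ)

/-- `w(x, τ) = ∫₀^τ (g₂ + D_x g₁ · v₁ - average) ds`. -/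
def wMap {n : ℕ} (g₁ g₂ : EuclideanSpace ℝ (Fin n) → ℝ → EuclideanSpace ℝ (Fin n)) (T : ℝ)
    (x : EuclideanSpace ℝ (Fin n)) (τ : ℝ) : EuclideanSpace ℝ (Fin n) :=
  ∫ s in (0 : ℝ)..τ, (g₂ x s + jac g₁ x s (v₁ g₁ x s) - avgOf g₁ g₂ T x)

/-- `v₂ = w - D_x v₁ · v₁`. -/
def v₂ {n : ℕ} (g₁ g₂ : EuclideanSpace ℝ (Fin n) → ℝ → EuclideanSpace ℝ (Fin n)) (T : ℝ)
    (x : EuclideanSpace ℝ (Fin n)) (τ : ℝ) : EuclideanSpace ℝ (Fin n) :=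
  wMap g₁ g₂ T x τ - jac (v₁ g₁) x τ (v₁ g₁ x τ)

/-- `Φ(x, τ) = x - ε v₁(x, τ) - ε² v₂(x, τ)`, the first component of the near-identity
transformation `Ψ(x, τ) = (Φ(x, τ), τ)`, built from the fields `f̂₁, f̂₂`. -/
def nearId {n : ℕ} (f₁ f₂ : EuclideanSpace ℝ (Fin n) → ℝ → EuclideanSpace ℝ (Fin n))
    (T δ₁ δ₂ ε : ℝ) (x : EuclideanSpace ℝ (Fin n)) (τ : ℝ) : EuclideanSpace ℝ (Fin n) :=
  x - ε • v₁ (cutoff δ₁ δ₂ f₁) x τ - ε ^ 2 • v₂ (cutoff δ₁ δ₂ f₁) (cutoff δ₁ δ₂ f₂) T x τ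

/-- The second-order average mapping `f̄` of the oscillatory system. -/
def avgField {n : ℕ} (f₁ f₂ : EuclideanSpace ℝ (Fin n) → ℝ → EuclideanSpace ℝ (Fin n))
    (T δ₁ δ₂ : ℝ) (x : EuclideanSpace ℝ (Fin n)) : EuclideanSpace ℝ (Fin n) :=
  avgOf (cutoff δ₁ δ₂ f₁) (cutoff δ₁ δ₂ f₂) T x

/-- The pushforward of the system `x' = f x τ`, `τ' = ε⁻²` under `Ψ(x, τ) = (Φ(x, τ), τ)`:
`(D_x Φ ∘ Ψ⁻¹) (f ∘ Ψ⁻¹) + ε⁻² (D_τ Φ ∘ Ψ⁻¹)`. As `Ψ` preserves `τ`, its inverse at `(x, τ)` is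
`(y, τ)` with `y` the inverse image of `x` under `Φ(·, τ)`. The `τ`-derivative is taken on
`[0, ∞)`. -/
def pushforward {n : ℕ} (Φ : EuclideanSpace ℝ (Fin n) → ℝ → EuclideanSpace ℝ (Fin n))
    (f : EuclideanSpace ℝ (Fin n) → ℝ → EuclideanSpace ℝ (Fin n)) (ε : ℝ)
    (x : EuclideanSpace ℝ (Fin n)) (τ : ℝ) : EuclideanSpace ℝ (Fin n) :=
  let y := Function.invFun (fun z => Φ z τ) x
  jac Φ y τ (f y τ) + (ε ^ 2)⁻¹ • derivWithin (fun s => Φ y s) (Ici 0) τ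

/-- The remainder `g` in `Ψ_* f_ε(x, τ) = f̄(x) + ε g(x, τ, ε)`, for `ε > 0`. -/
def remainder {n : ℕ} (f₁ f₂ : EuclideanSpace ℝ (Fin n) → ℝ → EuclideanSpace ℝ (Fin n))
    (T δ₁ δ₂ : ℝ) (x : EuclideanSpace ℝ (Fin n)) (τ ε : ℝ) : EuclideanSpace ℝ (Fin n) :=
  ε⁻¹ • (pushforward (nearId f₁ f₂ T δ₁ δ₂ ε) (oscField f₁ f₂ ε) ε x τ
    - avgField f₁ f₂ T δ₁ δ₂ x)

/-! ### The Lyapunov assumption -/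

/-- Growth condition (i): `|g(x, τ, ε)| ≤ L (φ(x) + 1)` for `|x| ≥ δ₃`, `τ ≥ 0` and all small
`ε > 0`. There `Ψ` is a diffeomorphism and `g` is given by `remainder`; it extends continuously to
`ε = 0`, so that the bound for `ε = 0` is implied. -/
def RemainderGrowth {n : ℕ} (f₁ f₂ : EuclideanSpace ℝ (Fin n) → ℝ → EuclideanSpace ℝ (Fin n))
    (T δ₁ δ₂ δ₃ : ℝ) (φ : EuclideanSpace ℝ (Fin n) → ℝ) : Prop :=
  ∃ ε₀ : ℝ, 0 < ε₀ ∧ ∃ L : ℝ, 0 < L ∧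
    ∀ x, δ₃ ≤ ‖x‖ → ∀ τ, 0 ≤ τ → ∀ ε, 0 < ε → ε ≤ ε₀ →
      ‖remainder f₁ f₂ T δ₁ δ₂ x τ ε‖ ≤ L * (φ x + 1)

/-- The Lyapunov assumption for given `δ = (δ₁, δ₂, δ₃)`, `V` and `φ`. -/
structure LyapunovAssumption {n : ℕ}
    (f₁ f₂ : EuclideanSpace ℝ (Fin n) → ℝ → EuclideanSpace ℝ (Fin n)) (T δ₁ δ₂ δ₃ : ℝ)
    (V φ : EuclideanSpace ℝ (Fin n) → ℝ) : Prop where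
  contDiff_V : ContDiff ℝ 1 V
  posDef : IsPosDefFun φ
  bounds_V : ∃ α₁ α₂ : ℝ → ℝ, IsClassKInf α₁ ∧ IsClassKInf α₂ ∧
    ∀ x, α₁ ‖x‖ ≤ V x ∧ V x ≤ α₂ ‖x‖
  gradient_le : ∃ c₂ : ℝ, 0 < c₂ ∧ ∀ x, ‖gradient V x‖ ≤ c₂ * φ x
  decrease : ∃ c₁ : ℝ, 0 < c₁ ∧
    ∀ x, δ₃ ≤ ‖x‖ → inner ℝ (gradient V x) (avgField f₁ f₂ T δ₁ δ₂ x) ≤ -c₁ * φ x ^ 2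
  growth : RemainderGrowth f₁ f₂ T δ₁ δ₂ δ₃ φ ∨
    ∃ α₃ : ℝ → ℝ, IsClassK α₃ ∧ ∀ x, α₃ ‖x‖ * ‖x‖ ≤ φ x

end OscAvg

end

open OscAvg

open Set Filter Topology

noncomputable section

namespace OscAvg

/-! ### Comparison functions and scalar differential inequalities -/

/-! With `δ₂ = 0` there is no cut-off, and every `δ₃ > 0` is admissible. Hence the averaged field
`f̄` is one fixed globally Lipschitz field, and the Lyapunov decrease holds outside every ball
around the origin.

Along a solution put `z = Φ(x, τ)`. The terms of order `ε⁻¹` and `1` that oscillate cancel, leaving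
`z' = f̄(z) + O(ε)(1 + |x|)` (`transported_sub_avgOf`, `exists_nearId_estimates`). The cancellation
rests on one identity: integrating by parts, `v₂` is the primitive of the zero-mean field `f₂ - D_x
v₁ f₁ - f̄` (`v₂_eq`). So `v₁` and `v₂` are both periodic primitives of Lipschitz fields and obey
the same estimates. Outside a ball of radius `δ`, either growth alternative turns the error into
`O(ε) φ(z)` (`exists_perturbation_bound`). Since `|∇V| ≤ c₂ φ`, it costs at most half of the
decrease `c₁ φ²` when `ε` is small.

The constant `c₁` may depend on `δ`, whereas `β` must not depend on `ν`. Therefore half of `-⟨∇V,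
f̄⟩` is first bounded below by a single monotone function `ρ(V)` (`exists_lyapunov_decay_rate`).
Then `V(z)` decays at rate `ρ(V)` until it reaches the level `α₂(δ)`. Monotonicity of `ρ` integrates
this to `V(z(t)) + t ρ(V(z(t))) ≤ V(z(0))`, with no comparison equation to solve, and `β` is the
implicit solution of such a relation. The distance `|z - x| ≤ Cε(1 + |x|)` goes into `ν` and into
the arguments of `α₁` and `α₂`.

For fixed `ε` the field is globally Lipschitz in `x`, so maximal solutions are complete. -/

theorem IsClassK.pos {α : ℝ → ℝ} (hα : IsClassK α) {r : ℝ} (hr : 0 < r) : 0 < α r := by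
  have := hα.strictMonoOn (mem_Ici.2 le_rfl) (mem_Ici.2 hr.le) hr
  rwa [hα.zero] at this

theorem IsClassK.nonneg {α : ℝ → ℝ} (hα : IsClassK α) {r : ℝ} (hr : 0 ≤ r) : 0 ≤ α r := by
  rcases hr.eq_or_lt with rfl | h
  · exact hα.zero.ge
  · exact (hα.pos h).le

theorem IsClassK.mono {α : ℝ → ℝ} (hα : IsClassK α) {r s : ℝ} (hr : 0 ≤ r) (h : r ≤ s) :
    α r ≤ α s :=
  hα.strictMonoOn.monotoneOn (mem_Ici.2 hr) (mem_Ici.2 (hr.trans h)) h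

theorem IsClassK.le_of_le {α : ℝ → ℝ} (hα : IsClassK α) {r s : ℝ} (hr : 0 ≤ r) (hs : 0 ≤ s)
    (h : α r ≤ α s) : r ≤ s :=
  (hα.strictMonoOn.le_iff_le (mem_Ici.2 hr) (mem_Ici.2 hs)).1 h

/-- Class `K` functions are small near the origin. -/
theorem IsClassK.exists_le {α : ℝ → ℝ} (hα : IsClassK α) {c : ℝ} (hc : 0 < c) :
    ∃ r, 0 < r ∧ α r ≤ c := by
  have h1 : Tendsto α (𝓝[>] 0) (𝓝 0) := by
    have := (hα.continuousOn 0 (mem_Ici.2 le_rfl)).tendsto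
    rw [hα.zero] at this
    exact this.mono_left (nhdsWithin_mono _ Ioi_subset_Ici_self)
  obtain ⟨r, hr, hr'⟩ := ((h1.eventually (ge_mem_nhds hc)).and self_mem_nhdsWithin).exists
  exact ⟨r, hr', hr⟩

/-- A function `W` that is bounded away from zero where `V` is dominates a continuous,
nondecreasing, positive function of `V`. -/
theorem exists_decay_rate {X : Type*} {V W : X → ℝ} {x₀ : X} (hW : ∀ x, 0 ≤ W x) (hV₀ : V x₀ = 0) (hW₀ : W x₀ = 0)
    (hpos : ∀ v, 0 < v → ∃ c, 0 < c ∧ ∀ x, v ≤ V x → c ≤ W x) :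
    ∃ ρ : ℝ → ℝ, Continuous ρ ∧ Monotone ρ ∧ ρ 0 = 0 ∧ (∀ v, 0 < v → 0 < ρ v) ∧
      ∀ x, ρ (V x) ≤ W x := by
  have : Nonempty X := ⟨x₀⟩
  -- The rate is the infimum over `x` of `W x` plus the penalty `(v - V x)⁺`. It is nondecreasing
  -- and 1-Lipschitz in `v` as an infimum of such functions, and the penalty vanishes at `v = V x`.
  have hnn : ∀ v x, 0 ≤ W x + max (v - V x) 0 := fun v x => add_nonneg (hW x) (le_max_right _ _)
  have hbdd : ∀ v, BddBelow (range fun x => W x + max (v - V x) 0) := fun v =>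
    ⟨0, by rintro _ ⟨x, rfl⟩; exact hnn v x⟩
  have hmono : Monotone fun v => ⨅ x, (W x + max (v - V x) 0) := fun v w hvw =>
    ciInf_mono (hbdd v) fun x => by
      have := max_le_max (sub_le_sub_right hvw (V x)) (le_refl (0 : ℝ)); linarith
  have hlip : ∀ v w, v ≤ w → (⨅ x, (W x + max (w - V x) 0)) ≤
      (⨅ x, (W x + max (v - V x) 0)) + (w - v) := by
    intro v w hvw
    rw [← sub_le_iff_le_add]
    refine le_ciInf fun x => ?_
    rw [sub_le_iff_le_add]
    refine (ciInf_le (hbdd w) x).trans ?_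
    have : max (w - V x) 0 ≤ max (v - V x) 0 + (w - v) :=
      max_le (by linarith [le_max_left (v - V x) 0]) (by linarith [le_max_right (v - V x) 0])
    linarith
  refine ⟨fun v => ⨅ x, (W x + max (v - V x) 0), ?_, hmono, ?_, ?_, ?_⟩
  · have : LipschitzWith 1 fun v => ⨅ x, (W x + max (v - V x) 0) := by
      refine LipschitzWith.of_dist_le_mul fun v w => ?_
      rw [Real.dist_eq, Real.dist_eq, NNReal.coe_one, one_mul]
      rcases le_total v w with h | h
      · rw [abs_sub_comm, abs_of_nonneg (sub_nonneg.2 (hmono h)), abs_sub_comm,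
          abs_of_nonneg (sub_nonneg.2 h)]
        linarith [hlip v w h]
      · rw [abs_of_nonneg (sub_nonneg.2 (hmono h)), abs_of_nonneg (sub_nonneg.2 h)]
        linarith [hlip w v h]
    exact this.continuous
  · refine le_antisymm ((ciInf_le (hbdd 0) x₀).trans ?_) (le_ciInf fun x => hnn 0 x)
    simp [hV₀, hW₀]
  · intro v hv
    -- Where `V x ≥ v / 2` the term `W x` is at least `c`; elsewhere the penalty is at least `v /
    -- 2`.
    obtain ⟨c, hc, h⟩ := hpos (v / 2) (half_pos hv)
    refine (lt_min hc (half_pos hv)).trans_le (le_ciInf fun x => ?_)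
    rcases le_total (v / 2) (V x) with hx | hx
    · exact (min_le_left _ _).trans
        ((h x hx).trans (le_add_of_nonneg_right (le_max_right _ _)))
    · refine (min_le_right _ _).trans ?_
      linarith [hW x, le_max_left (v - V x) 0]
  · intro x
    refine (ciInf_le (hbdd (V x)) x).trans ?_
    simp

/-- The class `KL` function defined implicitly by `G(β(r, t)) + t ρ(G(β(r, t))) = A(r)`. -/
theorem exists_classKL_of_implicit {G A ρ : ℝ → ℝ} (hG : IsClassKInf G) (hA : IsClassKInf A)
    (hρ : Continuous ρ) (hρm : Monotone ρ) (hρ0 : ρ 0 = 0) (hρpos : ∀ v, 0 < v → 0 < ρ v) :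
    ∃ β : ℝ → ℝ → ℝ, IsClassKL β ∧ ∀ r t b, 0 ≤ r → 0 ≤ t → 0 ≤ b →
      G b + t * ρ (G b) ≤ A r → b ≤ β r t := by
  have hρnn : ∀ v, 0 ≤ v → 0 ≤ ρ v := fun v hv => hρ0 ▸ hρm hv
  -- Each `H t` with `t ≥ 0` is strictly increasing on the half-line, so `β(·, t)` is its inverse
  -- composed with `A`. All properties of `β` are read off by comparing values of `H`.
  set H : ℝ → ℝ → ℝ := fun t b => G b + t * ρ (G b) with hH
  have hHmono : ∀ t, 0 ≤ t → ∀ b c, 0 ≤ b → b < c → H t b < H t c := by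
    intro t ht b c hb hbc
    have h1 := hG.strictMonoOn (mem_Ici.2 hb) (mem_Ici.2 (hb.trans hbc.le)) hbc
    exact add_lt_add_of_lt_of_le h1 (mul_le_mul_of_nonneg_left (hρm h1.le) ht)
  have hHle : ∀ t, 0 ≤ t → ∀ b c, 0 ≤ b → 0 ≤ c → H t b ≤ H t c → b ≤ c := by
    intro t ht b c hb hc h
    by_contra! hcb
    exact absurd (hHmono t ht c b hc hcb) (not_lt.2 h)
  have hHlt : ∀ t, 0 ≤ t → ∀ b c, 0 ≤ b → 0 ≤ c → H t b < H t c → b < c := by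
    intro t ht b c hb hc h
    by_contra! hcb
    rcases hcb.eq_or_lt with rfl | h'
    · exact lt_irrefl _ h
    · exact absurd (hHmono t ht c b hc h') (not_lt.2 h.le)
  have hH0 : ∀ t, H t 0 = 0 := fun t => by simp [hH, hG.zero, hρ0]
  -- Outside the quadrant the value `0` is arbitrary; it only keeps `β` nonnegative everywhere.
  have hex : ∀ r t : ℝ, ∃ b : ℝ, 0 ≤ b ∧ (0 ≤ r → 0 ≤ t → H t b = A r) := by
    intro r t
    by_cases hr : 0 ≤ r
    swap
    · exact ⟨0, le_rfl, fun h => absurd h hr⟩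
    by_cases ht : 0 ≤ t
    swap
    · exact ⟨0, le_rfl, fun _ h => absurd h ht⟩
    obtain ⟨M, hM, hM0⟩ := ((hG.tendsto_atTop.eventually_ge_atTop (A r)).and
      (eventually_ge_atTop (0 : ℝ))).exists
    have hcont : ContinuousOn (H t) (Icc 0 M) := by
      have := hG.continuousOn.mono (t := Icc 0 M) Icc_subset_Ici_self
      exact this.add (continuousOn_const.mul (hρ.comp_continuousOn this))
    have hmem : A r ∈ Icc (H t 0) (H t M) := by
      rw [hH0]
      refine ⟨hA.toIsClassK.nonneg hr, hM.trans ?_⟩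
      exact le_add_of_nonneg_right (mul_nonneg ht (hρnn _ (hG.toIsClassK.nonneg hM0)))
    obtain ⟨b, hb, hb'⟩ := intermediate_value_Icc hM0 hcont hmem
    exact ⟨b, hb.1, fun _ _ => hb'⟩
  choose β hβ0 hβ using hex
  have hcont : ContinuousOn (fun p : ℝ × ℝ => β p.1 p.2) (Ici 0 ×ˢ Ici 0) := by
    rintro ⟨r, t⟩ ⟨hr, ht⟩
    have hr' : 0 ≤ r := hr
    have ht' : 0 ≤ t := ht
    have hev : ∀ᶠ p : ℝ × ℝ in 𝓝[Ici 0 ×ˢ Ici 0] (r, t), 0 ≤ p.1 ∧ 0 ≤ p.2 :=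
      self_mem_nhdsWithin
    have hAc : Tendsto (fun p : ℝ × ℝ => A p.1) (𝓝[Ici 0 ×ˢ Ici 0] (r, t)) (𝓝 (A r)) :=
      (hA.continuousOn r hr).tendsto.comp
        (tendsto_nhdsWithin_iff.2 ⟨(continuous_fst.tendsto _).mono_left nhdsWithin_le_nhds,
          hev.mono fun p hp => hp.1⟩)
    have hHc : ∀ c, Tendsto (fun p : ℝ × ℝ => H p.2 c) (𝓝[Ici 0 ×ˢ Ici 0] (r, t))
        (𝓝 (H t c)) := fun c => by
      have : Continuous fun p : ℝ × ℝ => H p.2 c := by simp only [hH]; fun_prop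
      exact (this.tendsto (r, t)).mono_left nhdsWithin_le_nhds
    -- For `c ≥ 0`, `c < β(r, t)` means `H t c < A r`, an open condition in `(r, t)`; likewise for
    -- the reverse inequality.
    refine tendsto_order.2 ⟨fun c hc => ?_, fun c hc => ?_⟩
    · rcases lt_or_ge c 0 with hc0 | hc0
      · exact Eventually.of_forall fun p => hc0.trans_le (hβ0 _ _)
      · have h1 : H t c < A r := by
          rw [← hβ r t hr' ht']; exact hHmono t ht' _ _ hc0 hc
        filter_upwards [(hHc c).eventually_lt hAc h1, hev] with p hp hp0
        rw [← hβ p.1 p.2 hp0.1 hp0.2] at hp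
        exact hHlt _ hp0.2 _ _ hc0 (hβ0 _ _) hp
    · have hc0 : 0 ≤ c := (hβ0 r t).trans (le_of_lt hc)
      have h1 : A r < H t c := by
        rw [← hβ r t hr' ht']; exact hHmono t ht' _ _ (hβ0 _ _) hc
      filter_upwards [hAc.eventually_lt (hHc c) h1, hev] with p hp hp0
      rw [← hβ p.1 p.2 hp0.1 hp0.2] at hp
      exact hHlt _ hp0.2 _ _ (hβ0 _ _) hc0 hp
  refine ⟨β, ⟨hcont, fun s hs => ⟨⟨?_, ?_, ?_⟩, ?_⟩, ?_, ?_⟩, ?_⟩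
  · exact hcont.comp (f := fun r : ℝ => (r, s)) (by fun_prop) fun r hr => ⟨hr, hs⟩
  · intro r hr r' hr' hrr
    refine hHlt s hs _ _ (hβ0 _ _) (hβ0 _ _) ?_
    rw [hβ r s hr hs, hβ r' s hr' hs]
    exact hA.strictMonoOn hr hr' hrr
  · refine le_antisymm (hHle s hs _ _ (hβ0 _ _) le_rfl ?_) (hβ0 _ _)
    rw [hβ 0 s le_rfl hs, hH0, hA.zero]
  · refine tendsto_atTop.2 fun B => ?_
    filter_upwards [hA.tendsto_atTop.eventually_ge_atTop (H s (max B 0)),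
      eventually_ge_atTop (0 : ℝ)] with r hr hr0
    rw [← hβ r s hr0 hs] at hr
    exact (le_max_left _ _).trans (hHle s hs _ _ (le_max_right _ _) (hβ0 _ _) hr)
  · intro r hr s hs s' hs' hss
    have hb : 0 < β r s := by
      refine hHlt s hs _ _ le_rfl (hβ0 _ _) ?_
      rw [hH0, hβ r s hr.le hs]
      exact hA.toIsClassK.pos hr
    refine hHlt s' hs' _ _ (hβ0 _ _) (hβ0 _ _) ?_
    rw [hβ r s' hr.le hs', ← hβ r s hr.le hs]
    have := mul_lt_mul_of_pos_right hss (hρpos _ (hG.toIsClassK.pos hb))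
    simp only [hH]
    linarith
  · intro r hr
    refine tendsto_order.2 ⟨fun c hc => Eventually.of_forall fun s => hc.trans_le (hβ0 _ _),
      fun c hc => ?_⟩
    have hk := hρpos _ (hG.toIsClassK.pos hc)
    have h1 : Tendsto (fun s => s * ρ (G c)) atTop atTop :=
      tendsto_id.atTop_mul_const hk
    filter_upwards [h1.eventually_gt_atTop (A r), eventually_ge_atTop (0 : ℝ)] with s hs hs0
    refine hHlt s hs0 _ _ (hβ0 _ _) hc.le ?_
    rw [hβ r s hr hs0]
    exact hs.trans_le (le_add_of_nonneg_left (hG.toIsClassK.nonneg hc.le))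
  · intro r t b hr ht hb h
    refine hHle t ht _ _ hb (hβ0 _ _) ?_
    rw [hβ r t hr ht]
    exact h

theorem IsClassKInf.comp_mul_left {α : ℝ → ℝ} (hα : IsClassKInf α) {c : ℝ} (hc : 0 < c) :
    IsClassKInf fun r => α (c * r) where
  continuousOn := hα.continuousOn.comp (by fun_prop) fun r hr =>
    mem_Ici.2 (mul_nonneg hc.le (mem_Ici.1 hr))
  strictMonoOn := fun r hr s hs h => hα.strictMonoOn (mem_Ici.2 (mul_nonneg hc.le (mem_Ici.1 hr)))
    (mem_Ici.2 (mul_nonneg hc.le (mem_Ici.1 hs))) (mul_lt_mul_of_pos_left h hc)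
  zero := by simp [hα.zero]
  tendsto_atTop := hα.tendsto_atTop.comp (tendsto_id.const_mul_atTop hc)

/-- If `u' ≤ -ρ(u)` wherever `u > m`, then `u(t) ≤ m` or `u(t) + t ρ(u(t)) ≤ u(0)`. -/
theorem decay_of_deriv_le {u u' ρ : ℝ → ℝ} {m t : ℝ} (ht : 0 ≤ t)
    (hu : ∀ s ∈ Icc 0 t, HasDerivWithinAt u (u' s) (Icc 0 t) s) (hm : 0 ≤ m)
    (hρm : Monotone ρ) (hρpos : ∀ v, 0 < v → 0 < ρ v)
    (hle : ∀ s ∈ Icc 0 t, m < u s → u' s ≤ -ρ (u s)) :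
    u t ≤ m ∨ u t + t * ρ (u t) ≤ u 0 := by
  by_cases hmt : u t ≤ m
  · exact Or.inl hmt
  push Not at hmt
  right
  have hcont : ContinuousOn u (Icc 0 t) := fun s hs => (hu s hs).continuousWithinAt
  have hright : ∀ s ∈ Ico 0 t, HasDerivWithinAt u (u' s) (Ici s) s := fun s hs =>
    ((hu s ⟨hs.1, hs.2.le⟩).mono (Icc_subset_Icc_left hs.1)).mono_of_mem_nhdsWithin
      (Icc_mem_nhdsGE hs.2)
  -- The final value is the minimum: otherwise `u` would have to cross upwards some level `v > m`,
  -- where its derivative is negative.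
  have hge : ∀ s ∈ Icc 0 t, u t ≤ u s := by
    intro s hs
    by_contra! hlt
    obtain ⟨v, hv1, hv2⟩ := exists_between (max_lt hlt hmt)
    have hvm : m < v := (le_max_right _ _).trans_lt hv1
    have := image_le_of_deriv_right_lt_deriv_boundary (f := u) (f' := u') (a := s) (b := t)
      (hcont.mono (Icc_subset_Icc_left hs.1)) (fun r hr => hright r ⟨hs.1.trans hr.1, hr.2⟩)
      (B := fun _ => v) (B' := fun _ => 0) ((le_max_left _ _).trans hv1.le)
      (fun r => hasDerivAt_const r v) (fun r hr hrv => by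
        have h1 := hle r ⟨hs.1.trans hr.1, hr.2.le⟩ (by rw [hrv]; exact hvm)
        have h2 := hρpos (u r) (by rw [hrv]; exact hm.trans_lt hvm)
        linarith) (right_mem_Icc.2 hs.2)
    exact absurd hv2 (not_lt.2 this)
  -- On all of `[0, t]` one has `u ≥ u t > m`, so by monotonicity of `ρ` the slope is at most the
  -- constant `-ρ(u t)`.
  have := image_le_of_deriv_right_le_deriv_boundary (f := u) (f' := u') (a := 0) (b := t)
    hcont hright (B := fun s => u 0 - s * ρ (u t)) (B' := fun _ => - ρ (u t)) (by simp)
    (by fun_prop) (fun s _ => by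
      simpa using (((hasDerivAt_id s).mul_const (ρ (u t))).const_sub (u 0)).hasDerivWithinAt)
    (fun s hs => by
      have h1 := hge s ⟨hs.1, hs.2.le⟩
      exact (hle s ⟨hs.1, hs.2.le⟩ (hmt.trans_le h1)).trans (neg_le_neg (hρm h1)))
    (right_mem_Icc.2 ht)
  linarith

/-! ### Integrals depending on a parameter -/

section Integrals

open MeasureTheory
open scoped Interval

theorem intervalIntegrable_of_norm_le {G : Type*} [NormedAddCommGroup G] {f : ℝ → G} {a b C : ℝ}
    (hm : AEStronglyMeasurable f (volume.restrict (Ι a b))) (h : ∀ s ∈ Ι a b, ‖f s‖ ≤ C) :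
    IntervalIntegrable f volume a b :=
  (intervalIntegrable_const (c := C)).mono_fun' hm
    ((ae_restrict_iff' measurableSet_uIoc).2 (Eventually.of_forall h))

variable {E G : Type*} [NormedAddCommGroup E] [NormedSpace ℝ E]
  [NormedAddCommGroup G] [NormedSpace ℝ G]

/-- On a finite-dimensional space, operator-valued functions are measurable if they are so
pointwise. -/
theorem aestronglyMeasurable_of_apply [FiniteDimensional ℝ E] {μ : Measure ℝ}
    {A : ℝ → E →L[ℝ] G} (h : ∀ v, AEStronglyMeasurable (fun s => A s v) μ) :
    AEStronglyMeasurable A μ := by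
  set b := Module.finBasis ℝ E
  -- In a basis the operator is a finite sum of rank-one operators, each depending continuously on
  -- one vector `A s (b i)`.
  have hA : A = fun s => ∑ i, (LinearMap.toContinuousLinearMap (b.coord i)).smulRight
      (A s (b i)) := by
    funext s
    ext v
    have := congrArg (A s) (b.sum_repr v)
    simp only [map_sum, map_smul] at this
    simp [this]
  rw [hA]
  refine Finset.aestronglyMeasurable_fun_sum _ fun i _ => ?_
  have hc : Continuous fun w : G =>
      (LinearMap.toContinuousLinearMap (b.coord i)).smulRight w :=
    (ContinuousLinearMap.smulRightL ℝ E G (LinearMap.toContinuousLinearMap (b.coord i))).continuous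
  exact hc.comp_aestronglyMeasurable (h (b i))

/-- Differentiation under the integral sign for integrands that are differentiable and uniformly
Lipschitz in the parameter; no regularity of the derivative in the integration variable is
needed. -/
theorem hasFDerivAt_intervalIntegral [FiniteDimensional ℝ E] [CompleteSpace G]
    {F : E → ℝ → G} {a b C : ℝ} (hab : a ≤ b)
    (hint : ∀ x, IntervalIntegrable (F x) volume a b)
    (hlip : ∀ s ∈ Icc a b, ∀ x y, ‖F x s - F y s‖ ≤ C * ‖x - y‖)
    (hdiff : ∀ s ∈ Icc a b, Differentiable ℝ fun x => F x s) (x : E) :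
    IntervalIntegrable (fun s => fderiv ℝ (fun y => F y s) x) volume a b ∧
      HasFDerivAt (fun y => ∫ s in a..b, F y s) (∫ s in a..b, fderiv ℝ (fun y => F y s) x) x := by
  have hsub : Ι a b ⊆ Icc a b := by rw [uIoc_of_le hab]; exact Ioc_subset_Icc_self
  refine intervalIntegral.hasFDerivAt_integral_of_dominated_loc_of_lip (s := univ)
    (bound := fun _ => C) univ_mem (Eventually.of_forall fun y => (hint y).def'.aestronglyMeasurable)
    (hint x) (aestronglyMeasurable_of_apply fun v => ?_) ?_ intervalIntegrable_const ?_
  · have hlim : ∀ᵐ s ∂(volume.restrict (Ι a b)), Tendsto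
        (fun m : ℕ => (m : ℝ) • (F (x + (m : ℝ)⁻¹ • v) s - F x s)) atTop
        (𝓝 (fderiv ℝ (fun y => F y s) x v)) := by
      refine (ae_restrict_iff' measurableSet_uIoc).2 (Eventually.of_forall fun s hs => ?_)
      refine (hdiff s (hsub hs) x).hasFDerivAt.lim v ?_
      simpa using tendsto_natCast_atTop_atTop (R := ℝ)
    refine aestronglyMeasurable_of_tendsto_ae atTop (fun m => ?_) hlim
    exact (((hint _).def'.aestronglyMeasurable).sub (hint x).def'.aestronglyMeasurable).const_smul _
  · refine Eventually.of_forall fun s hs => LipschitzOnWith.of_dist_le_mul fun y _ z _ => ?_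
    rw [dist_eq_norm, dist_eq_norm, Real.coe_nnabs]
    exact (hlip s (hsub hs) y z).trans
      (mul_le_mul_of_nonneg_right (le_abs_self C) (norm_nonneg _))
  · exact Eventually.of_forall fun s hs => (hdiff s (hsub hs) x).hasFDerivAt

/-- Quadratic increments force a zero derivative. This replaces the product rule when a primitive
comes from a merely bounded measurable integrand and need not be differentiable everywhere. -/
theorem eq_of_norm_sub_le_mul_sq {f : ℝ → G} {a b C : ℝ} (hab : a ≤ b)
    (h : ∀ s t, a ≤ s → s ≤ t → t ≤ b → ‖f t - f s‖ ≤ C * (t - s) ^ 2) : f b = f a := by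
  have hd : ∀ s ∈ Icc a b, HasDerivWithinAt f 0 (Icc a b) s := by
    intro s hs
    rw [hasDerivWithinAt_iff_isLittleO]
    have h1 : (fun t => f t - f s - (t - s) • (0 : G)) =O[𝓝[Icc a b] s] fun t => (t - s) ^ 2 := by
      refine Asymptotics.IsBigO.of_bound C ?_
      filter_upwards [self_mem_nhdsWithin] with t ht
      rw [smul_zero, sub_zero, norm_pow, Real.norm_eq_abs, sq_abs]
      rcases le_total s t with hst | hst
      · exact h s t hs.1 hst ht.2
      · rw [norm_sub_rev, show (t - s) ^ 2 = (s - t) ^ 2 by ring]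
        exact h t s ht.1 hst hs.2
    refine h1.trans_isLittleO ?_
    have h2 : Tendsto (fun t : ℝ => t - s) (𝓝[Icc a b] s) (𝓝 0) := by
      have : Continuous fun t : ℝ => t - s := by fun_prop
      simpa using (this.tendsto s).mono_left nhdsWithin_le_nhds
    have h3 := (Asymptotics.isBigO_refl (fun t : ℝ => t - s) (𝓝[Icc a b] s)).mul_isLittleO
      ((Asymptotics.isLittleO_one_iff ℝ).2 h2)
    simpa [sq] using h3
  refine constant_of_has_deriv_right_zero (fun s hs => (hd s hs).continuousWithinAt)
    (fun s hs => ?_) b (right_mem_Icc.2 hab)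
  exact ((hd s ⟨hs.1, hs.2.le⟩).mono (Icc_subset_Icc_left hs.1)).mono_of_mem_nhdsWithin
    (Icc_mem_nhdsGE hs.2)

/-- Integration by parts for the primitive of a bounded measurable operator-valued function. -/
theorem integral_clm_apply_primitive [CompleteSpace E] [CompleteSpace G]
    {A : ℝ → E →L[ℝ] G} {b : ℝ → E} {τ C : ℝ}
    (hτ : 0 ≤ τ) (hA : IntervalIntegrable A volume 0 τ) (hAC : ∀ s ∈ Icc 0 τ, ‖A s‖ ≤ C)
    (hb : ContinuousOn b (Icc 0 τ)) :
    (∫ s in (0 : ℝ)..τ, A s (∫ r in (0 : ℝ)..s, b r)) +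
      ∫ s in (0 : ℝ)..τ, (∫ r in (0 : ℝ)..s, A r) (b s) =
        (∫ s in (0 : ℝ)..τ, A s) (∫ s in (0 : ℝ)..τ, b s) := by
  obtain ⟨D, hD⟩ := isCompact_Icc.exists_bound_of_continuousOn hb
  have hC : 0 ≤ C := (norm_nonneg _).trans (hAC 0 ⟨le_rfl, hτ⟩)
  have hD0 : 0 ≤ D := (norm_nonneg _).trans (hD 0 ⟨le_rfl, hτ⟩)
  have hAi : ∀ s ∈ Icc 0 τ, ∀ t ∈ Icc 0 τ, IntervalIntegrable A volume s t := fun s hs t ht =>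
    hA.mono_set (by rw [uIcc_of_le hτ]; exact uIcc_subset_Icc hs ht)
  have hbi : ∀ s ∈ Icc 0 τ, ∀ t ∈ Icc 0 τ, IntervalIntegrable b volume s t := fun s hs t ht =>
    (hb.mono (uIcc_subset_Icc hs ht)).intervalIntegrable
  have h0 : (0 : ℝ) ∈ Icc 0 τ := ⟨le_rfl, hτ⟩
  set M : ℝ → E →L[ℝ] G := fun s => ∫ r in (0 : ℝ)..s, A r with hM
  set B : ℝ → E := fun s => ∫ r in (0 : ℝ)..s, b r with hB
  have hMsub : ∀ s ∈ Icc 0 τ, ∀ t ∈ Icc 0 τ, M t - M s = ∫ r in s..t, A r := fun s hs t ht =>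
    intervalIntegral.integral_interval_sub_left (hAi 0 h0 t ht) (hAi 0 h0 s hs)
  have hBsub : ∀ s ∈ Icc 0 τ, ∀ t ∈ Icc 0 τ, B t - B s = ∫ r in s..t, b r := fun s hs t ht =>
    intervalIntegral.integral_interval_sub_left (hbi 0 h0 t ht) (hbi 0 h0 s hs)
  have hMn : ∀ s ∈ Icc 0 τ, ∀ t ∈ Icc 0 τ, ‖M t - M s‖ ≤ C * |t - s| := fun s hs t ht => by
    rw [hMsub s hs t ht]
    exact intervalIntegral.norm_integral_le_of_norm_le_const fun r hr =>
      hAC r (uIcc_subset_Icc hs ht (uIoc_subset_uIcc hr))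
  have hBn : ∀ s ∈ Icc 0 τ, ∀ t ∈ Icc 0 τ, ‖B t - B s‖ ≤ D * |t - s| := fun s hs t ht => by
    rw [hBsub s hs t ht]
    exact intervalIntegral.norm_integral_le_of_norm_le_const fun r hr =>
      hD r (uIcc_subset_Icc hs ht (uIoc_subset_uIcc hr))
  have hMc : ContinuousOn M (Icc 0 τ) := by
    refine LipschitzOnWith.continuousOn (K := Real.toNNReal C)
      (LipschitzOnWith.of_dist_le_mul fun s hs t ht => ?_)
    rw [dist_eq_norm, Real.dist_eq, Real.coe_toNNReal _ hC]
    exact hMn t ht s hs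
  have hBc : ContinuousOn B (Icc 0 τ) := by
    refine LipschitzOnWith.continuousOn (K := Real.toNNReal D)
      (LipschitzOnWith.of_dist_le_mul fun s hs t ht => ?_)
    rw [dist_eq_norm, Real.dist_eq, Real.coe_toNNReal _ hD0]
    exact hBn t ht s hs
  have hABi : ∀ g : ℝ → E, ContinuousOn g (Icc 0 τ) → ∀ s ∈ Icc 0 τ, ∀ t ∈ Icc 0 τ,
      IntervalIntegrable (fun r => A r (g r)) volume s t := by
    intro g hg s hs t ht
    have hsub : Ι s t ⊆ Icc 0 τ := uIoc_subset_uIcc.trans (uIcc_subset_Icc hs ht)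
    obtain ⟨D', hD'⟩ := isCompact_Icc.exists_bound_of_continuousOn hg
    refine intervalIntegrable_of_norm_le (C := C * D') ?_ fun r hr => ?_
    · have h1 := (hAi s hs t ht).def'.aestronglyMeasurable
      have h2 := ((hg.mono (uIcc_subset_Icc hs ht)).intervalIntegrable
        (μ := volume)).def'.aestronglyMeasurable
      exact (ContinuousLinearMap.apply ℝ G).aestronglyMeasurable_comp₂ h2 h1
    · exact (A r).le_of_opNorm_le_of_le (hAC r (hsub hr)) (hD' r (hsub hr))
  have hMbi : ∀ s ∈ Icc 0 τ, ∀ t ∈ Icc 0 τ,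
      IntervalIntegrable (fun r => M r (b r)) volume s t := fun s hs t ht =>
    ((hMc.clm_apply hb).mono (uIcc_subset_Icc hs ht)).intervalIntegrable
  -- The defect in the integration-by-parts formula vanishes at `0`; it suffices that its increment
  -- over `[s, t]` is `O((t - s)²)`.
  have key := eq_of_norm_sub_le_mul_sq (C := 2 * (C * D)) hτ (f := fun t =>
    (∫ s in (0 : ℝ)..t, A s (B s)) + (∫ s in (0 : ℝ)..t, M s (b s)) - M t (B t)) ?_
  · simp only [intervalIntegral.integral_same, hM, hB, map_zero, sub_zero, add_zero] at key
    exact sub_eq_zero.1 key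
  · intro s t hs0 hst htτ
    have hs : s ∈ Icc 0 τ := ⟨hs0, hst.trans htτ⟩
    have ht : t ∈ Icc 0 τ := ⟨hs0.trans hst, htτ⟩
    have hconst : ∀ w : E, IntervalIntegrable (fun r => A r w) volume s t := fun w =>
      hABi (fun _ => w) continuousOn_const s hs t ht
    have hMconst : IntervalIntegrable (fun r => M s (b r)) volume s t :=
      ((continuousOn_const.clm_apply hb).mono (uIcc_subset_Icc hs ht)).intervalIntegrable
    have hAw : ∀ w : E, (∫ r in s..t, A r) w = ∫ r in s..t, A r w := fun w =>
      ContinuousLinearMap.intervalIntegral_apply (hAi s hs t ht) w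
    have hMw : M s (∫ r in s..t, b r) = ∫ r in s..t, M s (b r) :=
      ((M s).intervalIntegral_comp_comm (hbi s hs t ht)).symm
    have e1 : M t (B t) - M s (B s) = (∫ r in s..t, A r (B t)) + ∫ r in s..t, M s (b r) := by
      rw [← hAw, ← hMw, ← hMsub s hs t ht, ← hBsub s hs t ht, map_sub,
        sub_apply]
      abel
    -- The increment is the integral of `A r (B r - B t) + (M r - M s) (b r)`. Since `B` and `M` are
    -- Lipschitz, the integrand is `O(t - s)`.
    have e2 : ((∫ s in (0 : ℝ)..t, A s (B s)) + (∫ s in (0 : ℝ)..t, M s (b s)) - M t (B t)) -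
        ((∫ r in (0 : ℝ)..s, A r (B r)) + (∫ r in (0 : ℝ)..s, M r (b r)) - M s (B s)) =
        ∫ r in s..t, (A r (B r) - A r (B t) + (M r (b r) - M s (b r))) := by
      rw [intervalIntegral.integral_add ((hABi B hBc s hs t ht).sub (hconst _))
        ((hMbi s hs t ht).sub hMconst), intervalIntegral.integral_sub (hABi B hBc s hs t ht)
        (hconst _), intervalIntegral.integral_sub (hMbi s hs t ht) hMconst,
        ← intervalIntegral.integral_interval_sub_left (hABi B hBc 0 h0 t ht) (hABi B hBc 0 h0 s hs),
        ← intervalIntegral.integral_interval_sub_left (hMbi 0 h0 t ht) (hMbi 0 h0 s hs)]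
      rw [sub_eq_iff_eq_add] at e1
      rw [e1]
      abel
    rw [e2]
    have hbound : ∀ r ∈ Ι s t, ‖A r (B r) - A r (B t) + (M r (b r) - M s (b r))‖ ≤
        2 * (C * D) * (t - s) := by
      intro r hr
      rw [uIoc_of_le hst] at hr
      have hr' : r ∈ Icc 0 τ := ⟨hs0.trans hr.1.le, hr.2.trans htτ⟩
      rw [← map_sub, ← sub_apply]
      have h1 : ‖A r (B r - B t)‖ ≤ C * (D * (t - s)) :=
        (A r).le_of_opNorm_le_of_le (hAC r hr') ((hBn t ht r hr').trans
          (mul_le_mul_of_nonneg_left (by rw [abs_sub_comm, abs_of_nonneg] <;> linarith [hr.1, hr.2])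
            hD0))
      have h2 : ‖(M r - M s) (b r)‖ ≤ C * (t - s) * D :=
        (M r - M s).le_of_opNorm_le_of_le ((hMn s hs r hr').trans
          (mul_le_mul_of_nonneg_left (by rw [abs_of_nonneg] <;> linarith [hr.1, hr.2]) hC))
          (hD r hr')
      calc _ ≤ _ := norm_add_le _ _
        _ ≤ C * (D * (t - s)) + C * (t - s) * D := add_le_add h1 h2
        _ = _ := by ring
    refine (intervalIntegral.norm_integral_le_of_norm_le_const hbound).trans (le_of_eq ?_)
    rw [abs_of_nonneg (sub_nonneg.2 hst)]
    ring

end Integrals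

/-! ### Periodic fields with zero mean -/

/-- Subtract `⌊s / T⌋` periods. Periodicity is only available for nonnegative times, hence the
natural floor and forward induction. -/
theorem exists_mem_Icc_eq_of_periodic {α : Type*} {h : ℝ → α} {T : ℝ} (hT : 0 < T)
    (hper : ∀ s, 0 ≤ s → h (s + T) = h s) {s : ℝ} (hs : 0 ≤ s) :
    ∃ r ∈ Icc 0 T, h s = h r := by
  have hk : ∀ k : ℕ, ∀ r, 0 ≤ r → h (r + k * T) = h r := by
    intro k
    induction k with
    | zero => intro r _; simp
    | succ k ih =>
      intro r hr
      rw [← ih r hr, ← hper (r + k * T) (by positivity)]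
      congr 1
      push_cast
      ring
  have h1 : (⌊s / T⌋₊ : ℝ) ≤ s / T := Nat.floor_le (by positivity)
  have h2 : s / T < ⌊s / T⌋₊ + 1 := Nat.lt_floor_add_one _
  rw [le_div_iff₀ hT] at h1
  rw [div_lt_iff₀ hT] at h2
  have h3 : 0 ≤ s - ⌊s / T⌋₊ * T := by linarith
  refine ⟨s - ⌊s / T⌋₊ * T, ⟨h3, by linarith⟩, ?_⟩
  have := hk ⌊s / T⌋₊ _ h3
  rwa [sub_add_cancel] at this

/-- A `T`-periodic field of zero mean which is uniformly Lipschitz and differentiable in space. -/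
structure OscillatingField {n : ℕ} (q : EuclideanSpace ℝ (Fin n) → ℝ → EuclideanSpace ℝ (Fin n))
    (T C : ℝ) : Prop where
  period_pos : 0 < T
  const_nonneg : 0 ≤ C
  continuousOn : ∀ x, ContinuousOn (q x) (Ici 0)
  lipschitz : ∀ τ, 0 ≤ τ → ∀ x y, ‖q x τ - q y τ‖ ≤ C * ‖x - y‖
  periodic : ∀ x τ, 0 ≤ τ → q x (τ + T) = q x τ
  integral_eq_zero : ∀ x, ∫ τ in (0 : ℝ)..T, q x τ = 0
  differentiable : ∀ τ, 0 ≤ τ → Differentiable ℝ fun x => q x τ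

/-- A uniformly Lipschitz periodic field has uniformly linear growth. -/
theorem exists_linear_growth {n : ℕ}
    {q : EuclideanSpace ℝ (Fin n) → ℝ → EuclideanSpace ℝ (Fin n)} {T C : ℝ} (hT : 0 < T)
    (hC : 0 ≤ C) (hcont : ContinuousOn (q 0) (Ici 0))
    (hlip : ∀ τ, 0 ≤ τ → ∀ x y, ‖q x τ - q y τ‖ ≤ C * ‖x - y‖)
    (hper : ∀ τ, 0 ≤ τ → q 0 (τ + T) = q 0 τ) :
    ∃ M, 0 ≤ M ∧ ∀ x τ, 0 ≤ τ → ‖q x τ‖ ≤ M * (1 + ‖x‖) := by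
  obtain ⟨D, hD⟩ := (isCompact_Icc (a := 0) (b := T)).exists_bound_of_continuousOn
    (hcont.mono Icc_subset_Ici_self)
  have hD0 : 0 ≤ D := (norm_nonneg _).trans (hD 0 ⟨le_rfl, hT.le⟩)
  refine ⟨D + C, by positivity, fun x τ hτ => ?_⟩
  obtain ⟨r, hr, hr'⟩ := exists_mem_Icc_eq_of_periodic hT hper hτ
  have h1 := hlip τ hτ x 0
  have h2 := hD r hr
  rw [← hr'] at h2
  rw [sub_zero] at h1
  have h3 : ‖q x τ‖ ≤ ‖q x τ - q 0 τ‖ + ‖q 0 τ‖ := by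
    simpa using norm_add_le (q x τ - q 0 τ) (q 0 τ)
  nlinarith [norm_nonneg x, mul_nonneg hD0 (norm_nonneg x)]

namespace OscillatingField

variable {n : ℕ} {q : EuclideanSpace ℝ (Fin n) → ℝ → EuclideanSpace ℝ (Fin n)} {T C : ℝ}

theorem intervalIntegrable (h : OscillatingField q T C) (x : EuclideanSpace ℝ (Fin n)) {s t : ℝ}
    (hs : 0 ≤ s) (ht : 0 ≤ t) : IntervalIntegrable (q x) MeasureTheory.volume s t :=
  ((h.continuousOn x).mono fun r hr => by
    rcases mem_uIcc.1 hr with hr | hr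
    · exact hs.trans hr.1
    · exact ht.trans hr.1).intervalIntegrable

theorem v₁_periodic (h : OscillatingField q T C) (x : EuclideanSpace ℝ (Fin n)) {τ : ℝ}
    (hτ : 0 ≤ τ) : v₁ q x (τ + T) = v₁ q x τ := by
  have hT := h.period_pos.le
  have e1 := intervalIntegral.integral_add_adjacent_intervals (h.intervalIntegrable x le_rfl hT)
    (h.intervalIntegrable x hT (by positivity : 0 ≤ τ + T))
  have e2 : ∫ s in T..(τ + T), q x s = ∫ s in (0 : ℝ)..τ, q x (s + T) := by
    rw [intervalIntegral.integral_comp_add_right (fun s => q x s) T, zero_add]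
  have e3 : ∫ s in (0 : ℝ)..τ, q x (s + T) = ∫ s in (0 : ℝ)..τ, q x s :=
    intervalIntegral.integral_congr fun s hs => by
      rw [uIcc_of_le hτ] at hs
      exact h.periodic x s hs.1
  rw [v₁, v₁, ← e1, e2, e3, h.integral_eq_zero x, zero_add]

/-- Zero mean makes the primitive periodic, so only integrals over at most one period matter and the
constant is uniform in `τ`. -/
theorem v₁_lipschitz (h : OscillatingField q T C) {τ : ℝ} (hτ : 0 ≤ τ)
    (x y : EuclideanSpace ℝ (Fin n)) : ‖v₁ q x τ - v₁ q y τ‖ ≤ T * C * ‖x - y‖ := by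
  obtain ⟨r, hr, hr'⟩ := exists_mem_Icc_eq_of_periodic (h := fun s => v₁ q x s - v₁ q y s)
    h.period_pos (fun s hs => by simp only [h.v₁_periodic _ hs]) hτ
  rw [hr', v₁, v₁, ← intervalIntegral.integral_sub (h.intervalIntegrable x le_rfl hr.1)
    (h.intervalIntegrable y le_rfl hr.1)]
  refine (intervalIntegral.norm_integral_le_of_norm_le_const (C := C * ‖x - y‖)
    fun s hs => ?_).trans ?_
  · rw [uIoc_of_le hr.1] at hs
    exact h.lipschitz s hs.1.le x y
  · rw [sub_zero, abs_of_nonneg hr.1]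
    have := mul_le_mul_of_nonneg_left hr.2 (mul_nonneg h.const_nonneg (norm_nonneg (x - y)))
    linarith

theorem hasDerivWithinAt_v₁ (h : OscillatingField q T C) (x : EuclideanSpace ℝ (Fin n)) {τ : ℝ}
    (hτ : 0 ≤ τ) : HasDerivWithinAt (v₁ q x) (q x τ) (Ici 0) τ := by
  have hc := h.continuousOn x
  -- Freezing the integrand at its value at `0` for negative times makes it continuous on the whole
  -- line, so that the two-sided fundamental theorem applies also at `τ = 0`.
  have hext : Continuous fun s => q x (max s 0) :=
    hc.comp_continuous (by fun_prop) fun s => mem_Ici.2 (le_max_right _ _)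
  have hd := (hext.integral_hasStrictDerivAt 0 τ).hasDerivAt
  rw [max_eq_left hτ] at hd
  refine hd.hasDerivWithinAt.congr_of_mem (fun t ht => ?_) hτ
  refine intervalIntegral.integral_congr fun s hs => ?_
  rw [uIcc_of_le ht] at hs
  simp only [max_eq_left hs.1]

theorem exists_v₁_growth (h : OscillatingField q T C) :
    ∃ M, 0 ≤ M ∧ ∀ x τ, 0 ≤ τ → ‖v₁ q x τ‖ ≤ M * (1 + ‖x‖) :=
  exists_linear_growth h.period_pos (mul_nonneg h.period_pos.le h.const_nonneg)
    (fun _ hτ => (h.hasDerivWithinAt_v₁ 0 hτ).continuousWithinAt)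
    (fun _ hτ => h.v₁_lipschitz hτ) fun _ hτ => h.v₁_periodic 0 hτ

theorem hasFDerivAt_v₁ (h : OscillatingField q T C) {τ : ℝ} (hτ : 0 ≤ τ)
    (x : EuclideanSpace ℝ (Fin n)) :
    IntervalIntegrable (jac q x) MeasureTheory.volume 0 τ ∧
      HasFDerivAt (fun y => v₁ q y τ) (∫ s in (0 : ℝ)..τ, jac q x s) x :=
  hasFDerivAt_intervalIntegral hτ (fun y => h.intervalIntegrable y le_rfl hτ)
    (fun s hs => h.lipschitz s hs.1) (fun s hs => h.differentiable s hs.1) x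

theorem differentiable_v₁ (h : OscillatingField q T C) {τ : ℝ} (hτ : 0 ≤ τ) :
    Differentiable ℝ fun y => v₁ q y τ := fun x => (h.hasFDerivAt_v₁ hτ x).2.differentiableAt

theorem jac_v₁_eq (h : OscillatingField q T C) {τ : ℝ} (hτ : 0 ≤ τ)
    (x : EuclideanSpace ℝ (Fin n)) : jac (v₁ q) x τ = ∫ s in (0 : ℝ)..τ, jac q x s :=
  (h.hasFDerivAt_v₁ hτ x).2.fderiv

theorem norm_jac_le {p : EuclideanSpace ℝ (Fin n) → ℝ → EuclideanSpace ℝ (Fin n)} {D τ : ℝ}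
    (hD : 0 ≤ D) (hp : ∀ x y, ‖p x τ - p y τ‖ ≤ D * ‖x - y‖) (x : EuclideanSpace ℝ (Fin n)) :
    ‖jac p x τ‖ ≤ D := by
  have : LipschitzWith (Real.toNNReal D) fun y => p y τ :=
    LipschitzWith.of_dist_le_mul fun y z => by
      rw [dist_eq_norm, dist_eq_norm, Real.coe_toNNReal _ hD]
      exact hp y z
  have := norm_fderiv_le_of_lipschitz ℝ (x₀ := x) this
  rwa [Real.coe_toNNReal _ hD] at this

theorem norm_jac_v₁_le (h : OscillatingField q T C) {τ : ℝ} (hτ : 0 ≤ τ)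
    (x : EuclideanSpace ℝ (Fin n)) : ‖jac (v₁ q) x τ‖ ≤ T * C :=
  norm_jac_le (mul_nonneg h.period_pos.le h.const_nonneg) (h.v₁_lipschitz hτ) x

/-- Chain rule for the primitive of an oscillating field along a curve. -/
theorem hasDerivWithinAt_v₁_comp (h : OscillatingField q T C) {S : Set ℝ}
    {x : ℝ → EuclideanSpace ℝ (Fin n)} {τ : ℝ → ℝ} {x' : EuclideanSpace ℝ (Fin n)} {τ' t : ℝ}
    (ht : t ∈ S) (hτ : ∀ s ∈ S, 0 ≤ τ s) (hx' : HasDerivWithinAt x x' S t)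
    (hτ' : HasDerivWithinAt τ τ' S t) :
    HasDerivWithinAt (fun s => v₁ q (x s) (τ s))
      (jac (v₁ q) (x t) (τ t) x' + τ' • q (x t) (τ t)) S t := by
  have h1 : HasDerivWithinAt (fun s => v₁ q (x s) (τ t)) (jac (v₁ q) (x t) (τ t) x') S t :=
    (h.differentiable_v₁ (hτ t ht) (x t)).hasFDerivAt.comp_hasDerivWithinAt t hx'
  have h2 : HasDerivWithinAt (fun s => v₁ q (x t) (τ s)) (τ' • q (x t) (τ t)) S t :=
    (h.hasDerivWithinAt_v₁ (x t) (hτ t ht)).scomp t hτ' hτ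
  -- The mixed second difference is the integral of `q (x s) - q (x t)` between `τ t` and `τ s`, of
  -- size `C |x s - x t| |τ s - τ t| = o(s - t)`. Hence partial derivatives suffice for the chain
  -- rule, without continuity of the Jacobian in time.
  have h3 : HasDerivWithinAt (fun s => v₁ q (x s) (τ s) - v₁ q (x t) (τ s)
      - (v₁ q (x s) (τ t) - v₁ q (x t) (τ t))) 0 S t := by
    rw [hasDerivWithinAt_iff_isLittleO]
    have hb : (fun s => v₁ q (x s) (τ s) - v₁ q (x t) (τ s)
        - (v₁ q (x s) (τ t) - v₁ q (x t) (τ t))) =O[𝓝[S] t]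
        fun s => ‖x s - x t‖ * (τ s - τ t) := by
      refine Asymptotics.IsBigO.of_bound C ?_
      filter_upwards [self_mem_nhdsWithin] with s hs
      have hi := fun y => h.intervalIntegrable y le_rfl (hτ s hs)
      have hi' := fun y => h.intervalIntegrable y le_rfl (hτ t ht)
      have e : v₁ q (x s) (τ s) - v₁ q (x t) (τ s) - (v₁ q (x s) (τ t) - v₁ q (x t) (τ t)) =
          ∫ r in (τ t)..(τ s), (q (x s) r - q (x t) r) := by
        rw [intervalIntegral.integral_sub (h.intervalIntegrable _ (hτ t ht) (hτ s hs))
          (h.intervalIntegrable _ (hτ t ht) (hτ s hs)),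
          ← intervalIntegral.integral_interval_sub_left (hi _) (hi' _),
          ← intervalIntegral.integral_interval_sub_left (hi _) (hi' _), v₁, v₁, v₁, v₁]
        abel
      rw [e, norm_mul, norm_norm, Real.norm_eq_abs, ← mul_assoc]
      refine intervalIntegral.norm_integral_le_of_norm_le_const fun r hr => ?_
      refine h.lipschitz r ?_ _ _
      exact (le_min (hτ t ht) (hτ s hs)).trans (mem_uIoc.1 hr |>.elim
        (fun hr => (min_le_left _ _).trans hr.1.le) fun hr => (min_le_right _ _).trans hr.1.le)
    have ho : (fun s => ‖x s - x t‖ * (τ s - τ t)) =o[𝓝[S] t] fun s => s - t := by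
      have hx0 : Tendsto (fun s => ‖x s - x t‖) (𝓝[S] t) (𝓝 0) := by
        have := (hx'.continuousWithinAt.tendsto.sub_const (x t)).norm
        simpa using this
      have := ((Asymptotics.isLittleO_one_iff ℝ).2 hx0).mul_isBigO
        hτ'.hasFDerivWithinAt.isBigO_sub
      simpa using this
    simpa using hb.trans_isLittleO ho
  have h4 := (h3.add h1).add h2
  rw [zero_add] at h4
  refine (h4.sub_const (v₁ q (x t) (τ t))).congr_of_mem (fun s _ => ?_) ht
  simp only [Pi.add_apply]
  abel

end OscillatingField

/-! ### Regularity of the second-order average -/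

/-- The regularity assumption on the whole space, with a common Lipschitz constant. -/
structure UniformRegularity {n : ℕ}
    (f₁ f₂ : EuclideanSpace ℝ (Fin n) → ℝ → EuclideanSpace ℝ (Fin n)) (T L : ℝ) : Prop where
  oscillating : OscillatingField f₁ T L
  continuousOn₂ : ∀ x, ContinuousOn (f₂ x) (Ici 0)
  lipschitz₂ : ∀ τ, 0 ≤ τ → ∀ x y, ‖f₂ x τ - f₂ y τ‖ ≤ L * ‖x - y‖
  periodic₂ : ∀ x τ, 0 ≤ τ → f₂ x (τ + T) = f₂ x τ
  differentiable₂ : ∀ τ, 0 ≤ τ → Differentiable ℝ fun x => f₂ x τ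
  differentiable_jac : ∀ τ, 0 ≤ τ → Differentiable ℝ fun x => jac f₁ x τ
  lipschitz_jac : ∀ τ₁ τ₂, 0 ≤ τ₁ → 0 ≤ τ₂ → ∀ x y,
    ‖jac f₁ x τ₁ (f₁ x τ₂) - jac f₁ y τ₁ (f₁ y τ₂)‖ ≤ L * ‖x - y‖

theorem contDiff_of_contDiffOnClosed {n k : ℕ}
    {h : EuclideanSpace ℝ (Fin n) → EuclideanSpace ℝ (Fin n)}
    (H : ContDiffOnClosed k h {x | 0 ≤ ‖x‖}) : ContDiff ℝ k h := by
  obtain ⟨U, -, hU, h⟩ := H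
  have : U = univ := eq_univ_of_forall fun x => hU (norm_nonneg x)
  rwa [this, contDiffOn_univ] at h

theorem RegularityAssumption.exists_uniformRegularity {n : ℕ}
    {f₁ f₂ : EuclideanSpace ℝ (Fin n) → ℝ → EuclideanSpace ℝ (Fin n)} {T : ℝ}
    (h : RegularityAssumption f₁ f₂ 0 T) : ∃ L, UniformRegularity f₁ f₂ T L := by
  obtain ⟨L₁, hL₁, h₁⟩ := h.lipschitz₁
  obtain ⟨L₂, hL₂, h₂⟩ := h.lipschitz₂
  obtain ⟨L₃, hL₃, h₃⟩ := h.lipschitz₃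
  have le : ∀ {a b : ℝ} {x y : EuclideanSpace ℝ (Fin n)}, a ≤ b →
      a * ‖x - y‖ ≤ b * ‖x - y‖ := fun hab => mul_le_mul_of_nonneg_right hab (norm_nonneg _)
  refine ⟨L₁ + L₂ + L₃, ⟨h.period_pos, by positivity, fun x => ?_, fun τ hτ x y => ?_,
    h.periodic₁, h.integral_eq_zero, fun τ hτ => ?_⟩, fun x => ?_, fun τ hτ x y => ?_,
    h.periodic₂, fun τ hτ => ?_, fun τ hτ => ?_, fun τ₁ τ₂ hτ₁ hτ₂ x y => ?_⟩
  · exact h.continuousOn₁.comp (f := fun s => (x, s)) (by fun_prop) fun s hs => ⟨mem_univ _, hs⟩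
  · exact (h₁ x y (norm_nonneg _) (norm_nonneg _) τ hτ).trans (le (by linarith))
  · exact (contDiff_of_contDiffOnClosed (h.contDiff₁ τ hτ)).differentiable (by norm_num)
  · exact h.continuousOn₂.comp (f := fun s => (x, s)) (by fun_prop) fun s hs => ⟨mem_univ _, hs⟩
  · exact (h₂ x y (norm_nonneg _) (norm_nonneg _) τ hτ).trans (le (by linarith))
  · exact (contDiff_of_contDiffOnClosed (h.contDiff₂ τ hτ)).differentiable (by norm_num)
  · have := (contDiff_of_contDiffOnClosed (h.contDiff₁ τ hτ)).fderiv_right (m := 1) (by norm_num)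
    exact this.differentiable (by norm_num)
  · exact (h₃ x y (norm_nonneg _) (norm_nonneg _) τ₁ τ₂ hτ₁ hτ₂).trans (le (by linarith))

/-- The directional derivative `D_x v₁ · f₁` of the primitive of a field along the field. -/
def selfAdvection {n : ℕ} (f : EuclideanSpace ℝ (Fin n) → ℝ → EuclideanSpace ℝ (Fin n))
    (x : EuclideanSpace ℝ (Fin n)) (τ : ℝ) : EuclideanSpace ℝ (Fin n) :=
  jac (v₁ f) x τ (f x τ)

/-- The zero-mean field whose primitive is `v₂`. -/
def secondOrderField {n : ℕ}
    (f₁ f₂ : EuclideanSpace ℝ (Fin n) → ℝ → EuclideanSpace ℝ (Fin n)) (T : ℝ)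
    (x : EuclideanSpace ℝ (Fin n)) (τ : ℝ) : EuclideanSpace ℝ (Fin n) :=
  f₂ x τ - selfAdvection f₁ x τ - avgOf f₁ f₂ T x

namespace UniformRegularity

open MeasureTheory

variable {n : ℕ} {f₁ f₂ : EuclideanSpace ℝ (Fin n) → ℝ → EuclideanSpace ℝ (Fin n)} {T L : ℝ}

theorem period_pos (h : UniformRegularity f₁ f₂ T L) : 0 < T := h.oscillating.period_pos

theorem const_nonneg (h : UniformRegularity f₁ f₂ T L) : 0 ≤ L := h.oscillating.const_nonneg

theorem norm_jac_le (h : UniformRegularity f₁ f₂ T L) {τ : ℝ} (hτ : 0 ≤ τ)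
    (x : EuclideanSpace ℝ (Fin n)) : ‖jac f₁ x τ‖ ≤ L :=
  OscillatingField.norm_jac_le h.const_nonneg (h.oscillating.lipschitz τ hτ) x

theorem selfAdvection_eq_integral (h : UniformRegularity f₁ f₂ T L) {τ : ℝ} (hτ : 0 ≤ τ)
    (x : EuclideanSpace ℝ (Fin n)) :
    selfAdvection f₁ x τ = ∫ r in (0 : ℝ)..τ, jac f₁ x r (f₁ x τ) := by
  rw [selfAdvection, h.oscillating.jac_v₁_eq hτ,
    ContinuousLinearMap.intervalIntegral_apply (h.oscillating.hasFDerivAt_v₁ hτ x).1]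

theorem selfAdvection_periodic (h : UniformRegularity f₁ f₂ T L) (x : EuclideanSpace ℝ (Fin n))
    {τ : ℝ} (hτ : 0 ≤ τ) : selfAdvection f₁ x (τ + T) = selfAdvection f₁ x τ := by
  have : (fun y => v₁ f₁ y (τ + T)) = fun y => v₁ f₁ y τ :=
    funext fun y => h.oscillating.v₁_periodic y hτ
  rw [selfAdvection, selfAdvection, jac, jac, this, h.oscillating.periodic x τ hτ]

theorem intervalIntegrable_jac_apply (h : UniformRegularity f₁ f₂ T L) {τ : ℝ} (hτ : 0 ≤ τ)
    (x v : EuclideanSpace ℝ (Fin n)) :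
    IntervalIntegrable (fun r => jac f₁ x r v) volume 0 τ :=
  have h' := (h.oscillating.hasFDerivAt_v₁ hτ x).1
  ⟨h'.1.apply_continuousLinearMap v, h'.2.apply_continuousLinearMap v⟩

/-- Moving the vector under the integral produces `D_x f₁(x, s) f₁(x, r)`, exactly the quantity
whose Lipschitz bound is assumed for independent times `s` and `r`. Periodicity limits the
integration to one period. -/
theorem selfAdvection_lipschitz (h : UniformRegularity f₁ f₂ T L) {τ : ℝ} (hτ : 0 ≤ τ)
    (x y : EuclideanSpace ℝ (Fin n)) :
    ‖selfAdvection f₁ x τ - selfAdvection f₁ y τ‖ ≤ T * L * ‖x - y‖ := by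
  obtain ⟨r, hr, hr'⟩ := exists_mem_Icc_eq_of_periodic
    (h := fun s => selfAdvection f₁ x s - selfAdvection f₁ y s)
    h.period_pos (fun s hs => by simp only [h.selfAdvection_periodic _ hs]) hτ
  rw [hr', h.selfAdvection_eq_integral hr.1, h.selfAdvection_eq_integral hr.1,
    ← intervalIntegral.integral_sub (h.intervalIntegrable_jac_apply hr.1 _ _)
      (h.intervalIntegrable_jac_apply hr.1 _ _)]
  refine (intervalIntegral.norm_integral_le_of_norm_le_const (C := L * ‖x - y‖)
    fun s hs => ?_).trans ?_
  · rw [uIoc_of_le hr.1] at hs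
    exact h.lipschitz_jac s r hs.1.le hr.1 x y
  · rw [sub_zero, abs_of_nonneg hr.1]
    have := mul_le_mul_of_nonneg_left hr.2 (mul_nonneg h.const_nonneg (norm_nonneg (x - y)))
    linarith

theorem differentiable_selfAdvection (h : UniformRegularity f₁ f₂ T L) {τ : ℝ} (hτ : 0 ≤ τ) :
    Differentiable ℝ fun x => selfAdvection f₁ x τ := by
  have e : (fun x => selfAdvection f₁ x τ) =
      fun x => ∫ r in (0 : ℝ)..τ, jac f₁ x r (f₁ x τ) :=
    funext fun x => h.selfAdvection_eq_integral hτ x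
  rw [e]
  exact fun x => (hasFDerivAt_intervalIntegral hτ
    (fun y => h.intervalIntegrable_jac_apply hτ y (f₁ y τ))
    (fun s hs => h.lipschitz_jac s τ hs.1 hτ)
    (fun s hs => (h.differentiable_jac s hs.1).clm_apply (h.oscillating.differentiable τ hτ))
    x).2.differentiableAt

/-- `D_x f₁` is bounded by `L`, so its primitive is `L`-Lipschitz in time. Thus `selfAdvection` is
continuous in time although `D_x f₁` itself is only known to be integrable. -/
theorem continuousOn_jac_v₁ (h : UniformRegularity f₁ f₂ T L) (x : EuclideanSpace ℝ (Fin n)) :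
    ContinuousOn (jac (v₁ f₁) x) (Ici 0) := by
  refine LipschitzOnWith.continuousOn (K := Real.toNNReal L)
    (LipschitzOnWith.of_dist_le_mul fun s hs t ht => ?_)
  have hi := fun r hr => (h.oscillating.hasFDerivAt_v₁ (τ := r) hr x).1
  rw [dist_eq_norm, Real.dist_eq, Real.coe_toNNReal _ h.const_nonneg,
    h.oscillating.jac_v₁_eq hs, h.oscillating.jac_v₁_eq ht,
    intervalIntegral.integral_interval_sub_left (hi s hs) (hi t ht)]
  refine intervalIntegral.norm_integral_le_of_norm_le_const fun r hr => h.norm_jac_le ?_ x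
  rcases mem_uIoc.1 hr with hr | hr
  · exact (mem_Ici.1 ht).trans hr.1.le
  · exact (mem_Ici.1 hs).trans hr.1.le

theorem continuousOn_selfAdvection (h : UniformRegularity f₁ f₂ T L)
    (x : EuclideanSpace ℝ (Fin n)) : ContinuousOn (selfAdvection f₁ x) (Ici 0) :=
  (h.continuousOn_jac_v₁ x).clm_apply (h.oscillating.continuousOn x)

theorem intervalIntegrable_of_continuousOn {g : ℝ → EuclideanSpace ℝ (Fin n)}
    (hg : ContinuousOn g (Ici 0)) {τ : ℝ} (hτ : 0 ≤ τ) : IntervalIntegrable g volume 0 τ :=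
  (hg.mono (by rw [uIcc_of_le hτ]; exact Icc_subset_Ici_self)).intervalIntegrable

/-- Integration by parts with `D_x v₁ = ∫ D_x f₁` and `v₁ = ∫ f₁`. It serves both to simplify the
average and to rewrite `v₂`. -/
theorem integral_jac_apply_v₁ (h : UniformRegularity f₁ f₂ T L) {τ : ℝ} (hτ : 0 ≤ τ)
    (x : EuclideanSpace ℝ (Fin n)) :
    IntervalIntegrable (fun s => jac f₁ x s (v₁ f₁ x s)) volume 0 τ ∧
    (∫ s in (0 : ℝ)..τ, jac f₁ x s (v₁ f₁ x s)) + ∫ s in (0 : ℝ)..τ, selfAdvection f₁ x s =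
      jac (v₁ f₁) x τ (v₁ f₁ x τ) := by
  have hi := (h.oscillating.hasFDerivAt_v₁ hτ x).1
  have hv : ContinuousOn (v₁ f₁ x) (Icc 0 τ) := fun s hs =>
    ((h.oscillating.hasDerivWithinAt_v₁ x hs.1).continuousWithinAt).mono Icc_subset_Ici_self
  refine ⟨?_, ?_⟩
  · obtain ⟨D, hD⟩ := isCompact_Icc.exists_bound_of_continuousOn hv
    refine intervalIntegrable_of_norm_le (C := L * D) ?_ fun r hr => ?_
    · have h2 : IntervalIntegrable (v₁ f₁ x) volume 0 τ :=
        (hv.mono (by rw [uIcc_of_le hτ])).intervalIntegrable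
      exact (ContinuousLinearMap.apply ℝ (EuclideanSpace ℝ (Fin n))).aestronglyMeasurable_comp₂
        h2.def'.aestronglyMeasurable hi.def'.aestronglyMeasurable
    · rw [uIoc_of_le hτ] at hr
      exact (jac f₁ x r).le_of_opNorm_le_of_le (h.norm_jac_le hr.1.le x) (hD r ⟨hr.1.le, hr.2⟩)
  · have := integral_clm_apply_primitive hτ hi (fun s hs => h.norm_jac_le hs.1 x)
      ((h.oscillating.continuousOn x).mono Icc_subset_Ici_self)
    rw [h.oscillating.jac_v₁_eq hτ x]
    refine Eq.trans ?_ this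
    congr 1
    refine intervalIntegral.integral_congr fun s hs => ?_
    rw [uIcc_of_le hτ] at hs
    simp only [selfAdvection, h.oscillating.jac_v₁_eq hs.1]

/-- Over a full period the boundary term vanishes because `v₁(x, T) = 0`. The two halves of the Lie
bracket then have equal integrals, which removes the factor `1/2`. -/
theorem avgOf_eq (h : UniformRegularity f₁ f₂ T L) (x : EuclideanSpace ℝ (Fin n)) :
    avgOf f₁ f₂ T x = T⁻¹ • ∫ s in (0 : ℝ)..T, (f₂ x s - selfAdvection f₁ x s) := by
  have hT := h.period_pos
  have hf₂ := intervalIntegrable_of_continuousOn (h.continuousOn₂ x) hT.le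
  have hK := intervalIntegrable_of_continuousOn (h.continuousOn_selfAdvection x) hT.le
  obtain ⟨hJ, e⟩ := h.integral_jac_apply_v₁ hT.le x
  have hv0 : v₁ f₁ x T = 0 := h.oscillating.integral_eq_zero x
  rw [hv0, map_zero, add_eq_zero_iff_eq_neg] at e
  have e2 : (∫ τ in (0 : ℝ)..T, ((2 : ℝ) • f₂ x τ + bracket (v₁ f₁) f₁ x τ)) =
      (2 : ℝ) • ∫ s in (0 : ℝ)..T, (f₂ x s - selfAdvection f₁ x s) := by
    have hB : IntervalIntegrable (bracket (v₁ f₁) f₁ x) volume 0 T := hJ.sub hK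
    have h2f : IntervalIntegrable (fun τ => (2 : ℝ) • f₂ x τ) volume 0 T := hf₂.smul (2 : ℝ)
    rw [intervalIntegral.integral_add h2f hB, intervalIntegral.integral_smul,
      intervalIntegral.integral_sub hf₂ hK]
    have : (∫ τ in (0 : ℝ)..T, bracket (v₁ f₁) f₁ x τ) =
        (∫ s in (0 : ℝ)..T, jac f₁ x s (v₁ f₁ x s)) - ∫ s in (0 : ℝ)..T, selfAdvection f₁ x s :=
      intervalIntegral.integral_sub hJ hK
    rw [this, e]
    module
  rw [avgOf, e2, smul_smul]
  congr 1
  field_simp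

theorem avgOf_lipschitz (h : UniformRegularity f₁ f₂ T L) (x y : EuclideanSpace ℝ (Fin n)) :
    ‖avgOf f₁ f₂ T x - avgOf f₁ f₂ T y‖ ≤ (L + T * L) * ‖x - y‖ := by
  have hT := h.period_pos
  have hi := fun x => (intervalIntegrable_of_continuousOn (h.continuousOn₂ x) hT.le).sub
    (intervalIntegrable_of_continuousOn (h.continuousOn_selfAdvection x) hT.le)
  rw [h.avgOf_eq, h.avgOf_eq, ← smul_sub, norm_smul, norm_inv, Real.norm_of_nonneg hT.le,
    inv_mul_le_iff₀ hT, ← intervalIntegral.integral_sub (hi x) (hi y)]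
  refine (intervalIntegral.norm_integral_le_of_norm_le_const
    (C := (L + T * L) * ‖x - y‖) fun s hs => ?_).trans (le_of_eq ?_)
  · rw [uIoc_of_le hT.le] at hs
    have h1 := h.lipschitz₂ s hs.1.le x y
    have h2 := h.selfAdvection_lipschitz hs.1.le x y
    have h3 := norm_sub_le (f₂ x s - f₂ y s) (selfAdvection f₁ x s - selfAdvection f₁ y s)
    rw [sub_sub_sub_comm, add_mul]
    linarith
  · rw [sub_zero, abs_of_nonneg hT.le]
    ring

theorem differentiable_avgOf (h : UniformRegularity f₁ f₂ T L) :
    Differentiable ℝ (avgOf f₁ f₂ T) := by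
  have hT := h.period_pos
  rw [show avgOf f₁ f₂ T = _ from funext h.avgOf_eq]
  have hi := fun x => (intervalIntegrable_of_continuousOn (h.continuousOn₂ x) hT.le).sub
    (intervalIntegrable_of_continuousOn (h.continuousOn_selfAdvection x) hT.le)
  have hd : Differentiable ℝ fun x => ∫ s in (0 : ℝ)..T, (f₂ x s - selfAdvection f₁ x s) :=
    fun x => (hasFDerivAt_intervalIntegral (C := L + T * L) hT.le hi (fun s hs x y => by
      have h1 := h.lipschitz₂ s hs.1 x y
      have h2 := h.selfAdvection_lipschitz hs.1 x y
      have h3 := norm_sub_le (f₂ x s - f₂ y s) (selfAdvection f₁ x s - selfAdvection f₁ y s)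
      rw [sub_sub_sub_comm, add_mul]
      linarith) (fun s hs => (h.differentiable₂ s hs.1).sub (h.differentiable_selfAdvection hs.1))
      x).2.differentiableAt
  exact hd.const_smul T⁻¹

theorem oscillating_secondOrderField (h : UniformRegularity f₁ f₂ T L) :
    OscillatingField (secondOrderField f₁ f₂ T) T (2 * (L + T * L)) where
  period_pos := h.period_pos
  const_nonneg := by
    have := h.period_pos
    have := h.const_nonneg
    positivity
  continuousOn x := ((h.continuousOn₂ x).sub (h.continuousOn_selfAdvection x)).sub
    continuousOn_const
  lipschitz τ hτ x y := by
    have h1 := h.lipschitz₂ τ hτ x y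
    have h2 := h.selfAdvection_lipschitz hτ x y
    have h3 := norm_sub_le (f₂ x τ - f₂ y τ) (selfAdvection f₁ x τ - selfAdvection f₁ y τ)
    have h4 := h.avgOf_lipschitz x y
    have h5 := norm_sub_le ((f₂ x τ - f₂ y τ) - (selfAdvection f₁ x τ - selfAdvection f₁ y τ))
      (avgOf f₁ f₂ T x - avgOf f₁ f₂ T y)
    simp only [secondOrderField]
    rw [sub_sub_sub_comm, sub_sub_sub_comm (f₂ x τ)]
    linarith
  periodic x τ hτ := by
    simp only [secondOrderField, h.periodic₂ x τ hτ, h.selfAdvection_periodic x hτ]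
  integral_eq_zero x := by
    have hT := h.period_pos
    simp only [secondOrderField]
    rw [intervalIntegral.integral_sub
      ((intervalIntegrable_of_continuousOn (h.continuousOn₂ x) hT.le).sub
        (intervalIntegrable_of_continuousOn (h.continuousOn_selfAdvection x) hT.le))
      intervalIntegrable_const, intervalIntegral.integral_const, h.avgOf_eq x, sub_zero,
      smul_inv_smul₀ hT.ne', sub_self]
  differentiable τ hτ := ((h.differentiable₂ τ hτ).sub (h.differentiable_selfAdvection hτ)).sub
    h.differentiable_avgOf

/-- The integral of `D_x f₁ v₁` inside `wMap` combines with the boundary term `D_x v₁ v₁` to leave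
minus the integral of `selfAdvection`. Everything known about primitives of oscillating fields now
applies to `v₂`. -/
theorem v₂_eq (h : UniformRegularity f₁ f₂ T L) {τ : ℝ} (hτ : 0 ≤ τ)
    (x : EuclideanSpace ℝ (Fin n)) : v₂ f₁ f₂ T x τ = v₁ (secondOrderField f₁ f₂ T) x τ := by
  obtain ⟨hJ, e⟩ := h.integral_jac_apply_v₁ hτ x
  have hf₂ := intervalIntegrable_of_continuousOn (h.continuousOn₂ x) hτ
  have hK := intervalIntegrable_of_continuousOn (h.continuousOn_selfAdvection x) hτ
  have hc : IntervalIntegrable (fun _ : ℝ => avgOf f₁ f₂ T x) volume 0 τ := intervalIntegrable_const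
  simp only [v₂, wMap, v₁, secondOrderField] at e hJ ⊢
  rw [← e, intervalIntegral.integral_sub (hf₂.add hJ) hc, intervalIntegral.integral_add hf₂ hJ,
    intervalIntegral.integral_sub (hf₂.sub hK) hc, intervalIntegral.integral_sub hf₂ hK]
  abel

end UniformRegularity

/-! ### The near-identity transformation without cut-off -/

theorem cutoff_zero_zero {n : ℕ}
    (f : EuclideanSpace ℝ (Fin n) → ℝ → EuclideanSpace ℝ (Fin n)) : cutoff 0 0 f = f := by
  funext x τ
  simp [cutoff, bump]

theorem avgField_zero_zero {n : ℕ}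
    (f₁ f₂ : EuclideanSpace ℝ (Fin n) → ℝ → EuclideanSpace ℝ (Fin n)) (T : ℝ) :
    avgField f₁ f₂ T 0 0 = avgOf f₁ f₂ T := by
  funext x
  rw [avgField, cutoff_zero_zero, cutoff_zero_zero]

/-- The velocity of `Φ(x, τ)` along the system, at the point `(y, τ)`. -/
def transported {n : ℕ} (f₁ f₂ : EuclideanSpace ℝ (Fin n) → ℝ → EuclideanSpace ℝ (Fin n))
    (T ε : ℝ) (y : EuclideanSpace ℝ (Fin n)) (τ : ℝ) : EuclideanSpace ℝ (Fin n) :=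
  jac (nearId f₁ f₂ T 0 0 ε) y τ (oscField f₁ f₂ ε y τ) +
    (ε ^ 2)⁻¹ • derivWithin (fun s => nearId f₁ f₂ T 0 0 ε y s) (Ici 0) τ

/-- Injectivity makes `Function.invFun` return `y` itself. Evaluating the remainder only at images
of `Φ` makes surjectivity unnecessary. -/
theorem remainder_nearId {n : ℕ}
    {f₁ f₂ : EuclideanSpace ℝ (Fin n) → ℝ → EuclideanSpace ℝ (Fin n)} {T ε τ : ℝ}
    (hinj : Function.Injective fun z => nearId f₁ f₂ T 0 0 ε z τ)
    (y : EuclideanSpace ℝ (Fin n)) :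
    remainder f₁ f₂ T 0 0 (nearId f₁ f₂ T 0 0 ε y τ) τ ε =
      ε⁻¹ • (transported f₁ f₂ T ε y τ - avgOf f₁ f₂ T (nearId f₁ f₂ T 0 0 ε y τ)) := by
  have : Function.invFun (fun z => nearId f₁ f₂ T 0 0 ε z τ) (nearId f₁ f₂ T 0 0 ε y τ) = y :=
    Function.leftInverse_invFun hinj y
  rw [remainder, pushforward, this, avgField_zero_zero, transported]

namespace UniformRegularity

variable {n : ℕ} {f₁ f₂ : EuclideanSpace ℝ (Fin n) → ℝ → EuclideanSpace ℝ (Fin n)} {T L : ℝ}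

theorem nearId_eq (h : UniformRegularity f₁ f₂ T L) (ε : ℝ) {τ : ℝ} (hτ : 0 ≤ τ)
    (x : EuclideanSpace ℝ (Fin n)) :
    nearId f₁ f₂ T 0 0 ε x τ =
      x - ε • v₁ f₁ x τ - ε ^ 2 • v₁ (secondOrderField f₁ f₂ T) x τ := by
  rw [nearId, cutoff_zero_zero, cutoff_zero_zero, h.v₂_eq hτ]

theorem jac_nearId (h : UniformRegularity f₁ f₂ T L) (ε : ℝ) {τ : ℝ} (hτ : 0 ≤ τ)
    (x : EuclideanSpace ℝ (Fin n)) :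
    jac (nearId f₁ f₂ T 0 0 ε) x τ = ContinuousLinearMap.id ℝ _ - ε • jac (v₁ f₁) x τ -
      ε ^ 2 • jac (v₁ (secondOrderField f₁ f₂ T)) x τ := by
  have h1 := (h.oscillating.differentiable_v₁ hτ x).hasFDerivAt
  have h2 := (h.oscillating_secondOrderField.differentiable_v₁ hτ x).hasFDerivAt
  have h3 := ((hasFDerivAt_id x).sub (h1.const_smul ε)).sub (h2.const_smul (ε ^ 2))
  have e : (fun y => nearId f₁ f₂ T 0 0 ε y τ) = fun y =>
      y - ε • v₁ f₁ y τ - ε ^ 2 • v₁ (secondOrderField f₁ f₂ T) y τ :=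
    funext fun y => h.nearId_eq ε hτ y
  rw [jac, e]
  exact h3.fderiv

theorem derivWithin_nearId (h : UniformRegularity f₁ f₂ T L) (ε : ℝ) {τ : ℝ} (hτ : 0 ≤ τ)
    (x : EuclideanSpace ℝ (Fin n)) :
    derivWithin (fun s => nearId f₁ f₂ T 0 0 ε x s) (Ici 0) τ =
      -(ε • f₁ x τ) - ε ^ 2 • secondOrderField f₁ f₂ T x τ := by
  have h1 := h.oscillating.hasDerivWithinAt_v₁ x hτ
  have h2 := h.oscillating_secondOrderField.hasDerivWithinAt_v₁ x hτ
  have h3 := ((h1.const_smul ε).const_sub x).sub (h2.const_smul (ε ^ 2))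
  refine HasDerivWithinAt.derivWithin ?_ ((uniqueDiffOn_Ici (0 : ℝ)) τ hτ)
  exact h3.congr_of_mem (fun s hs => h.nearId_eq ε hs x) hτ

theorem transported_eq (h : UniformRegularity f₁ f₂ T L) (ε : ℝ) {τ : ℝ} (hτ : 0 ≤ τ)
    (y : EuclideanSpace ℝ (Fin n)) :
    transported f₁ f₂ T ε y τ = oscField f₁ f₂ ε y τ
      - ε • (jac (v₁ f₁) y τ (oscField f₁ f₂ ε y τ) + (ε ^ 2)⁻¹ • f₁ y τ)
      - ε ^ 2 • (jac (v₁ (secondOrderField f₁ f₂ T)) y τ (oscField f₁ f₂ ε y τ)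
        + (ε ^ 2)⁻¹ • secondOrderField f₁ f₂ T y τ) := by
  rw [transported, h.jac_nearId ε hτ, h.derivWithin_nearId ε hτ]
  simp only [sub_apply, smul_apply, ContinuousLinearMap.id_apply]
  module

/-- Chain rule: `Φ` maps solutions of the oscillatory system to solutions of the transported
one. -/
theorem hasDerivWithinAt_nearId_comp (h : UniformRegularity f₁ f₂ T L) {ε : ℝ} {S : Set ℝ}
    {x : ℝ → EuclideanSpace ℝ (Fin n)} {τ : ℝ → ℝ} {t : ℝ} (ht : t ∈ S)
    (hτ : ∀ s ∈ S, 0 ≤ τ s)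
    (hx' : HasDerivWithinAt x (oscField f₁ f₂ ε (x t) (τ t)) S t)
    (hτ' : HasDerivWithinAt τ ((ε ^ 2)⁻¹) S t) :
    HasDerivWithinAt (fun s => nearId f₁ f₂ T 0 0 ε (x s) (τ s))
      (transported f₁ f₂ T ε (x t) (τ t)) S t := by
  have h1 := h.oscillating.hasDerivWithinAt_v₁_comp ht hτ hx' hτ'
  have h2 := h.oscillating_secondOrderField.hasDerivWithinAt_v₁_comp ht hτ hx' hτ'
  have h3 := (hx'.sub (h1.const_smul ε)).sub (h2.const_smul (ε ^ 2))
  rw [h.transported_eq ε (hτ t ht)]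
  exact h3.congr_of_mem (fun s hs => h.nearId_eq ε (hτ s hs) (x s)) ht

/-- The terms `ε⁻¹ f₁` cancel against the time derivative of `ε v₁`. At order one, `f₂` and `-D_x v₁
f₁` cancel against the time derivative of `ε² v₂`, which leaves `f̄`. -/
theorem transported_sub_avgOf (h : UniformRegularity f₁ f₂ T L) {ε : ℝ} (hε : ε ≠ 0) {τ : ℝ}
    (hτ : 0 ≤ τ) (y : EuclideanSpace ℝ (Fin n)) :
    transported f₁ f₂ T ε y τ - avgOf f₁ f₂ T y =
      -(ε • (jac (v₁ f₁) y τ (f₂ y τ) + jac (v₁ (secondOrderField f₁ f₂ T)) y τ (f₁ y τ)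
        + ε • jac (v₁ (secondOrderField f₁ f₂ T)) y τ (f₂ y τ))) := by
  rw [h.transported_eq ε hτ]
  simp only [oscField, map_add, map_smul, secondOrderField, selfAdvection]
  match_scalars <;> field_simp <;> ring

/-- The transformation is a small Lipschitz perturbation of the identity, and the transported
field is a perturbation of the average with linear growth. -/
theorem exists_nearId_estimates (h : UniformRegularity f₁ f₂ T L) :
    ∃ C, 0 < C ∧ ∀ ε, 0 < ε → ε ≤ 1 → ∀ τ, 0 ≤ τ →
      (∀ x, ‖nearId f₁ f₂ T 0 0 ε x τ - x‖ ≤ C * ε * (1 + ‖x‖)) ∧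
      (∀ x y, ‖(nearId f₁ f₂ T 0 0 ε x τ - x) - (nearId f₁ f₂ T 0 0 ε y τ - y)‖
        ≤ C * ε * ‖x - y‖) ∧
      ∀ y, ‖transported f₁ f₂ T ε y τ - avgOf f₁ f₂ T (nearId f₁ f₂ T 0 0 ε y τ)‖
        ≤ C * ε * (1 + ‖y‖) := by
  have hL := h.const_nonneg
  have hT := h.period_pos
  have h₂ := h.oscillating_secondOrderField
  obtain ⟨M₁, hM₁, hv₁⟩ := h.oscillating.exists_v₁_growth
  obtain ⟨M₂, hM₂, hv₂⟩ := h₂.exists_v₁_growth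
  obtain ⟨N₁, hN₁, hf₁⟩ := exists_linear_growth hT hL (h.oscillating.continuousOn 0)
    h.oscillating.lipschitz (h.oscillating.periodic 0)
  obtain ⟨N₂, hN₂, hf₂⟩ := exists_linear_growth hT hL (h.continuousOn₂ 0) h.lipschitz₂
    (h.periodic₂ 0)
  set K := 2 * (L + T * L) with hK
  have hK0 : 0 ≤ K := h₂.const_nonneg
  have hA : 0 ≤ L + T * L := by positivity
  have hsmall : ∀ ε : ℝ, 0 < ε → ε ≤ 1 → ∀ a b : ℝ, 0 ≤ a → 0 ≤ b →
      ε * a + ε ^ 2 * b ≤ ε * (a + b) := fun ε hε hε1 a b ha hb => by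
    have := mul_le_mul_of_nonneg_right hε1 (mul_nonneg hε.le hb)
    nlinarith
  have hnorm : ∀ ε : ℝ, 0 < ε → ε ≤ 1 → ∀ a b : EuclideanSpace ℝ (Fin n),
      ‖-(ε • a) - ε ^ 2 • b‖ ≤ ε * (‖a‖ + ‖b‖) := fun ε hε hε1 a b => by
    refine (norm_sub_le _ _).trans (le_trans (le_of_eq ?_)
      (hsmall ε hε hε1 _ _ (norm_nonneg a) (norm_nonneg b)))
    rw [norm_neg, norm_smul, norm_smul, Real.norm_of_nonneg hε.le,
      Real.norm_of_nonneg (sq_nonneg ε)]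
  -- The first summand is the Lipschitz constant of `f̄` times the displacement `|Φ(y) - y|`; the
  -- others bound the three terms of order `ε` or higher left after the cancellation.
  set D := (L + T * L) * (M₁ + M₂) + (T * L * N₂ + T * K * N₁ + T * K * N₂) with hD
  have hD0 : 0 ≤ D := by positivity
  refine ⟨(M₁ + M₂) + (T * L + T * K) + D + 1, by positivity, fun ε hε hε1 τ hτ => ?_⟩
  have hid : ∀ x, ‖nearId f₁ f₂ T 0 0 ε x τ - x‖ ≤ (M₁ + M₂) * ε * (1 + ‖x‖) := by
    intro x
    rw [h.nearId_eq ε hτ]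
    have e : x - ε • v₁ f₁ x τ - ε ^ 2 • v₁ (secondOrderField f₁ f₂ T) x τ - x =
        -(ε • v₁ f₁ x τ) - ε ^ 2 • v₁ (secondOrderField f₁ f₂ T) x τ := by module
    rw [e]
    refine (hnorm ε hε hε1 _ _).trans ?_
    have := mul_le_mul_of_nonneg_left (add_le_add (hv₁ x τ hτ) (hv₂ x τ hτ)) hε.le
    linarith
  have hle : ∀ a r : ℝ, a ≤ (M₁ + M₂) + (T * L + T * K) + D + 1 → 0 ≤ r →
      a * ε * r ≤ ((M₁ + M₂) + (T * L + T * K) + D + 1) * ε * r := fun a r ha hr =>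
    mul_le_mul_of_nonneg_right (mul_le_mul_of_nonneg_right ha hε.le) hr
  have p1 : 0 ≤ M₁ + M₂ := by positivity
  have p2 : 0 ≤ T * L + T * K := by positivity
  refine ⟨fun x => (hid x).trans (hle _ _ (by linarith) (by positivity)), fun x y => ?_,
    fun y => ?_⟩
  · refine le_trans ?_ (hle (T * L + T * K) _ (by linarith) (norm_nonneg _))
    rw [h.nearId_eq ε hτ, h.nearId_eq ε hτ]
    have e : x - ε • v₁ f₁ x τ - ε ^ 2 • v₁ (secondOrderField f₁ f₂ T) x τ - x -
        (y - ε • v₁ f₁ y τ - ε ^ 2 • v₁ (secondOrderField f₁ f₂ T) y τ - y) =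
        -(ε • (v₁ f₁ x τ - v₁ f₁ y τ)) - ε ^ 2 • (v₁ (secondOrderField f₁ f₂ T) x τ -
          v₁ (secondOrderField f₁ f₂ T) y τ) := by module
    rw [e]
    refine (hnorm ε hε hε1 _ _).trans ?_
    have := mul_le_mul_of_nonneg_left (add_le_add (h.oscillating.v₁_lipschitz hτ x y)
      (h₂.v₁_lipschitz hτ x y)) hε.le
    linarith
  · refine le_trans ?_ (hle D _ (by linarith) (by positivity))
    rw [← sub_add_sub_cancel _ (avgOf f₁ f₂ T y)]
    refine (norm_add_le _ _).trans ?_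
    have h1 : ‖avgOf f₁ f₂ T y - avgOf f₁ f₂ T (nearId f₁ f₂ T 0 0 ε y τ)‖ ≤
        (L + T * L) * ((M₁ + M₂) * ε * (1 + ‖y‖)) := by
      refine (h.avgOf_lipschitz _ _).trans (mul_le_mul_of_nonneg_left ?_ hA)
      rw [norm_sub_rev]
      exact hid y
    have h2 : ‖transported f₁ f₂ T ε y τ - avgOf f₁ f₂ T y‖ ≤
        ε * ((T * L * N₂ + T * K * N₁ + T * K * N₂) * (1 + ‖y‖)) := by
      rw [h.transported_sub_avgOf hε.ne' hτ, norm_neg, norm_smul, Real.norm_of_nonneg hε.le]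
      refine mul_le_mul_of_nonneg_left ?_ hε.le
      refine (norm_add₃_le).trans ?_
      have a1 := (jac (v₁ f₁) y τ).le_of_opNorm_le_of_le (h.oscillating.norm_jac_v₁_le hτ y)
        (hf₂ y τ hτ)
      have a2 := (jac (v₁ (secondOrderField f₁ f₂ T)) y τ).le_of_opNorm_le_of_le
        (h₂.norm_jac_v₁_le hτ y) (hf₁ y τ hτ)
      have a3 := (jac (v₁ (secondOrderField f₁ f₂ T)) y τ).le_of_opNorm_le_of_le
        (h₂.norm_jac_v₁_le hτ y) (hf₂ y τ hτ)
      have a4 : ‖ε • jac (v₁ (secondOrderField f₁ f₂ T)) y τ (f₂ y τ)‖ ≤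
          ‖jac (v₁ (secondOrderField f₁ f₂ T)) y τ (f₂ y τ)‖ := by
        rw [norm_smul, Real.norm_of_nonneg hε.le]
        exact mul_le_of_le_one_left (norm_nonneg _) hε1
      linarith
    calc _ ≤ _ := add_le_add h2 h1
      _ = _ := by rw [hD]; ring

end UniformRegularity

/-! ### Completeness of maximal solutions -/

theorem lifeSpan_coe (b : ℝ) : lifeSpan (b : EReal) = Ico 0 b := by
  ext t
  simp [lifeSpan]

theorem Icc_subset_lifeSpan {ts : EReal} {t : ℝ} (ht : t ∈ lifeSpan ts) :
    Icc 0 t ⊆ lifeSpan ts := fun _ hs =>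
  ⟨hs.1, lt_of_le_of_lt (EReal.coe_le_coe_iff.2 hs.2) ht.2⟩

variable {n : ℕ}

theorem IsSolution.zero_mem {f : EuclideanSpace ℝ (Fin n) → ℝ → EuclideanSpace ℝ (Fin n)} {ε : ℝ}
    {x₀ : EuclideanSpace ℝ (Fin n)} {τ₀ : ℝ} {ts : EReal} {x : ℝ → EuclideanSpace ℝ (Fin n)}
    {τ : ℝ → ℝ} (h : IsSolution f ε x₀ τ₀ ts x τ) : (0 : ℝ) ∈ lifeSpan ts :=
  ⟨le_rfl, by simpa using h.pos⟩

theorem IsSolution.τ_eq {f : EuclideanSpace ℝ (Fin n) → ℝ → EuclideanSpace ℝ (Fin n)} {ε : ℝ}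
    {x₀ : EuclideanSpace ℝ (Fin n)} {τ₀ : ℝ} {ts : EReal} {x : ℝ → EuclideanSpace ℝ (Fin n)}
    {τ : ℝ → ℝ} (h : IsSolution f ε x₀ τ₀ ts x τ) {t : ℝ} (ht : t ∈ lifeSpan ts) :
    τ t = τ₀ + (ε ^ 2)⁻¹ * t := by
  have hsub := Icc_subset_lifeSpan ht
  have hd : ∀ s ∈ Icc 0 t, HasDerivWithinAt (fun r => τ r - (ε ^ 2)⁻¹ * r) 0 (Icc 0 t) s :=
    fun s hs => by
      have := ((h.deriv_τ s (hsub hs)).mono hsub).sub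
        ((hasDerivWithinAt_id s (Icc 0 t)).const_mul ((ε ^ 2)⁻¹))
      rwa [mul_one, sub_self] at this
  have := constant_of_has_deriv_right_zero (fun s hs => (hd s hs).continuousWithinAt)
    (fun s hs => ((hd s ⟨hs.1, hs.2.le⟩).mono
      (Icc_subset_Icc_left hs.1)).mono_of_mem_nhdsWithin (Icc_mem_nhdsGE hs.2)) t
    (right_mem_Icc.2 ht.1)
  simp only [mul_zero, sub_zero, h.init_τ] at this
  linarith

/-- Curves satisfying the differential equations on `[0, b)` are solutions. -/
theorem isSolution_of_hasDerivWithinAt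
    {f : EuclideanSpace ℝ (Fin n) → ℝ → EuclideanSpace ℝ (Fin n)}
    (hf : ContinuousOn (fun p : EuclideanSpace ℝ (Fin n) × ℝ => f p.1 p.2) (univ ×ˢ Ici 0))
    {ε b τ₀ : ℝ} (hb : 0 < b) (hτ₀ : 0 ≤ τ₀) {x : ℝ → EuclideanSpace ℝ (Fin n)}
    (hx : ∀ t ∈ Ico 0 b,
      HasDerivWithinAt x (f (x t) (τ₀ + (ε ^ 2)⁻¹ * t)) (Ico 0 b) t) :
    IsSolution f ε (x 0) τ₀ (b : EReal) x fun t => τ₀ + (ε ^ 2)⁻¹ * t := by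
  have hτ : ∀ t ∈ Ico 0 b, 0 ≤ τ₀ + (ε ^ 2)⁻¹ * t := fun t ht =>
    add_nonneg hτ₀ (mul_nonneg (inv_nonneg.2 (sq_nonneg ε)) ht.1)
  have hxc : ContinuousOn x (Ico 0 b) := fun t ht => (hx t ht).continuousWithinAt
  refine ⟨by exact_mod_cast hb, rfl, by simp, ?_, ?_, ?_, ?_, ?_⟩ <;> rw [lifeSpan_coe]
  · exact hτ
  · rw [contDiffOn_one_iff_derivWithin (uniqueDiffOn_Ico 0 b)]
    refine ⟨fun t ht => (hx t ht).differentiableWithinAt, ?_⟩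
    refine ContinuousOn.congr (f := fun t => f (x t) (τ₀ + (ε ^ 2)⁻¹ * t)) ?_ fun t ht =>
      (hx t ht).derivWithin (uniqueDiffOn_Ico 0 b t ht)
    exact hf.comp (hxc.prodMk (by fun_prop)) fun t ht => ⟨mem_univ _, hτ t ht⟩
  · fun_prop
  · exact hx
  · intro t _
    simpa using (((hasDerivAt_id t).const_mul ((ε ^ 2)⁻¹)).const_add τ₀).hasDerivWithinAt

/-- Maximal solutions of a globally Lipschitz system are complete. -/
theorem IsMaximalSolution.eq_top {f : EuclideanSpace ℝ (Fin n) → ℝ → EuclideanSpace ℝ (Fin n)}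
    (hf : ContinuousOn (fun p : EuclideanSpace ℝ (Fin n) × ℝ => f p.1 p.2) (univ ×ˢ Ici 0))
    {K : ℝ} (hK : 0 ≤ K) (hlip : ∀ τ, 0 ≤ τ → ∀ x y, ‖f x τ - f y τ‖ ≤ K * ‖x - y‖) {ε : ℝ}
    {x₀ : EuclideanSpace ℝ (Fin n)} {τ₀ : ℝ} {ts : EReal} {x : ℝ → EuclideanSpace ℝ (Fin n)}
    {τ : ℝ → ℝ} (h : IsMaximalSolution f ε x₀ τ₀ ts x τ) : ts = ⊤ := by
  obtain ⟨hs, hmax⟩ := h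
  have hτ₀ : 0 ≤ τ₀ := hs.init_τ ▸ hs.τ_nonneg 0 hs.zero_mem
  induction ts using EReal.rec with
  | bot => exact absurd hs.pos (by simp)
  | top => rfl
  | coe b =>
    exfalso
    have hb : 0 < b := by exact_mod_cast hs.pos
    have hc : 0 ≤ (ε ^ 2)⁻¹ := inv_nonneg.2 (sq_nonneg ε)
    set F : ℝ → EuclideanSpace ℝ (Fin n) → EuclideanSpace ℝ (Fin n) :=
      fun t y => f y (τ₀ + (ε ^ 2)⁻¹ * t) with hF
    have hτ : ∀ t, 0 ≤ t → 0 ≤ τ₀ + (ε ^ 2)⁻¹ * t := fun t ht =>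
      add_nonneg hτ₀ (mul_nonneg hc ht)
    have hFlip : ∀ t, 0 ≤ t → ∀ S, LipschitzOnWith (Real.toNNReal K) (F t) S := fun t ht S =>
      LipschitzOnWith.of_dist_le_mul fun y _ z _ => by
        rw [dist_eq_norm, dist_eq_norm, Real.coe_toNNReal _ hK]
        exact hlip _ (hτ t ht) y z
    have hFc : ∀ y, ContinuousOn (fun t => F t y) (Ici 0) := fun y =>
      hf.comp (f := fun t => (y, τ₀ + (ε ^ 2)⁻¹ * t)) (by fun_prop)
        fun t ht => ⟨mem_univ _, hτ t ht⟩
    have hxd : ∀ t ∈ Ico 0 b, HasDerivWithinAt x (F t (x t)) (Ico 0 b) t := fun t ht => by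
      rw [← lifeSpan_coe] at ht ⊢
      have := hs.deriv_x t ht
      rwa [hs.τ_eq ht] at this
    obtain ⟨D, hD⟩ := (isCompact_Icc (a := 0) (b := b + 1)).exists_bound_of_continuousOn
      ((hFc 0).mono Icc_subset_Ici_self)
    have hD0 : 0 ≤ D := (norm_nonneg _).trans (hD 0 ⟨le_rfl, by linarith⟩)
    set M := D + K with hM
    have hM0 : 0 ≤ M := by positivity
    have hgrow : ∀ t ∈ Icc 0 (b + 1), ∀ y, ‖F t y‖ ≤ M * (1 + ‖y‖) := fun t ht y => by
      have h1 := hlip _ (hτ t ht.1) y 0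
      rw [sub_zero] at h1
      have h2 := hD t ht
      have h3 : ‖F t y‖ ≤ ‖F t y - F t 0‖ + ‖F t 0‖ := by
        simpa using norm_add_le (F t y - F t 0) (F t 0)
      have h4 : ‖F t y - F t 0‖ ≤ K * ‖y‖ := h1
      nlinarith [mul_nonneg hD0 (norm_nonneg y)]
    -- On the ball of radius `1 + |x t₁|` around `x t₁` the speed is at most `2 M (1 + |x t₁|)`, so
    -- `2 M η ≤ 1` keeps the solution inside for time `η`. As `η` does not depend on `t₁`,
    -- restarting at `t₁ > b - η` passes the supposed end time `b`.
    set η := (2 * M + 1)⁻¹ with hη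
    have hη0 : 0 < η := by positivity
    have hη1 : η ≤ 1 := inv_le_one_of_one_le₀ (by linarith)
    have hη2 : 2 * M * η ≤ 1 := by
      rw [hη, ← div_eq_mul_inv, div_le_one (by positivity)]
      linarith
    obtain ⟨t₁, ht₁, ht₁b⟩ := exists_between (max_lt hb (sub_lt_self b hη0))
    have ht₁0 : 0 < t₁ := (le_max_left _ _).trans_lt ht₁
    have hbt : b < t₁ + η := by linarith [(le_max_right _ _).trans_lt ht₁]
    have hsub : Icc t₁ (t₁ + η) ⊆ Icc 0 (b + 1) := Icc_subset_Icc ht₁0.le (by linarith)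
    have hPL : IsPicardLindelof F (tmin := t₁) (tmax := t₁ + η) ⟨t₁, le_rfl, by linarith⟩ (x t₁)
        (Real.toNNReal (1 + ‖x t₁‖)) 0 (Real.toNNReal (2 * M * (1 + ‖x t₁‖)))
        (Real.toNNReal K) := by
      refine ⟨fun t ht => hFlip t (ht₁0.le.trans ht.1) _,
        fun y _ => (hFc y).mono fun t ht => ht₁0.le.trans ht.1, fun t ht y hy => ?_, ?_⟩
      · rw [Real.coe_toNNReal _ (by positivity)]
        rw [Metric.mem_closedBall, dist_eq_norm, Real.coe_toNNReal _ (by positivity)] at hy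
        have h1 : ‖y‖ ≤ ‖y - x t₁‖ + ‖x t₁‖ := by simpa using norm_add_le (y - x t₁) (x t₁)
        have h2 := mul_le_mul_of_nonneg_left
          (by linarith : 1 + ‖y‖ ≤ 2 * (1 + ‖x t₁‖)) hM0
        linarith [hgrow t (hsub ht) y]
      · rw [Real.coe_toNNReal _ (by positivity), Real.coe_toNNReal _ (by positivity)]
        simp only [add_sub_cancel_left, sub_self, NNReal.coe_zero, sub_zero]
        rw [max_eq_left hη0.le]
        have := mul_le_mul_of_nonneg_right hη2 (by positivity : 0 ≤ 1 + ‖x t₁‖)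
        linarith
    obtain ⟨α, hα0, hα⟩ := hPL.exists_eq_forall_mem_Icc_hasDerivWithinAt₀
    simp only at hα0
    have heq : ∀ t ∈ Ico t₁ b, x t = α t := by
      intro t ht
      have hI : Icc t₁ t ⊆ Ico 0 b := fun s hs' => ⟨ht₁0.le.trans hs'.1, hs'.2.trans_lt ht.2⟩
      have hI' : Icc t₁ t ⊆ Icc t₁ (t₁ + η) := Icc_subset_Icc_right (by linarith [ht.2])
      have hx1 : ∀ s ∈ Icc t₁ t, HasDerivWithinAt x (F s (x s)) (Icc t₁ t) s := fun s hs' =>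
        (hxd s (hI hs')).mono hI
      have hα1 : ∀ s ∈ Icc t₁ t, HasDerivWithinAt α (F s (α s)) (Icc t₁ t) s := fun s hs' =>
        (hα s (hI' hs')).mono hI'
      have hr : ∀ s ∈ Ico t₁ t, Icc t₁ t ∈ 𝓝[Ici s] s := fun s hs' =>
        mem_of_superset (Icc_mem_nhdsGE hs'.2) (Icc_subset_Icc_left hs'.1)
      exact ODE_solution_unique_of_mem_Icc_right (v := F) (s := fun _ => univ)
        (K := Real.toNNReal K) (fun s hs' => hFlip s (ht₁0.le.trans hs'.1) _)
        (fun s hs' => (hx1 s hs').continuousWithinAt)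
        (fun s hs' => (hx1 s ⟨hs'.1, hs'.2.le⟩).mono_of_mem_nhdsWithin (hr s hs'))
        (fun _ _ => mem_univ _)
        (fun s hs' => (hα1 s hs').continuousWithinAt)
        (fun s hs' => (hα1 s ⟨hs'.1, hs'.2.le⟩).mono_of_mem_nhdsWithin (hr s hs'))
        (fun _ _ => mem_univ _) hα0.symm (right_mem_Icc.2 ht.1)
    classical
    -- The curves agree on `[t₁, b)`, so near any time the glued curve coincides with one of them
    -- and solves the equation beyond `b`.
    set y : ℝ → EuclideanSpace ℝ (Fin n) := fun t => if t < b then x t else α t with hy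
    have hyx : ∀ t, t < b → y t = x t := fun t ht => if_pos ht
    have hyα : ∀ t, t₁ ≤ t → y t = α t := fun t ht => by
      by_cases htb : t < b
      · rw [hyx t htb, heq t ⟨ht, htb⟩]
      · exact if_neg htb
    have hyd : ∀ t ∈ Ico 0 (t₁ + η), HasDerivWithinAt y (F t (y t)) (Ico 0 (t₁ + η)) t := by
      intro t ht
      rcases lt_or_ge t b with htb | htb
      · rw [hyx t htb]
        have h1 : HasDerivWithinAt x (F t (x t)) (Ico 0 (t₁ + η)) t :=
          (hxd t ⟨ht.1, htb⟩).mono_of_mem_nhdsWithin (by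
            filter_upwards [self_mem_nhdsWithin, mem_nhdsWithin_of_mem_nhds (Iio_mem_nhds htb)]
              with s hs1 hs2 using ⟨hs1.1, hs2⟩)
        refine h1.congr_of_eventuallyEq ?_ (hyx t htb)
        filter_upwards [mem_nhdsWithin_of_mem_nhds (Iio_mem_nhds htb)] with s hs2 using hyx s hs2
      · have htt : t₁ < t := ht₁b.trans_le htb
        rw [hyα t htt.le]
        have h1 : HasDerivWithinAt α (F t (α t)) (Ico 0 (t₁ + η)) t :=
          (hα t ⟨htt.le, ht.2.le⟩).mono_of_mem_nhdsWithin (by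
            filter_upwards [self_mem_nhdsWithin, mem_nhdsWithin_of_mem_nhds (Ioi_mem_nhds htt)]
              with s hs1 hs2 using ⟨le_of_lt hs2, hs1.2.le⟩)
        refine h1.congr_of_eventuallyEq ?_ (hyα t htt.le)
        filter_upwards [mem_nhdsWithin_of_mem_nhds (Ioi_mem_nhds htt)] with s hs2
          using hyα s (le_of_lt hs2)
    have hsol := isSolution_of_hasDerivWithinAt hf (hb.trans hbt) hτ₀ hyd
    rw [hyx 0 hb, hs.init_x] at hsol
    have := hmax _ _ _ hsol (by exact_mod_cast hbt.le) fun t ht => by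
      refine ⟨hyx t ?_, (hs.τ_eq ht).symm⟩
      rw [lifeSpan_coe] at ht
      exact ht.2
    exact hbt.ne' (by exact_mod_cast this)

/-! ### Practical stability -/

theorem IsPosDefFun.nonneg {φ : EuclideanSpace ℝ (Fin n) → ℝ} (hφ : IsPosDefFun φ)
    (x : EuclideanSpace ℝ (Fin n)) : 0 ≤ φ x := by
  obtain ⟨α, hα, h⟩ := hφ.lower
  exact (hα.nonneg (norm_nonneg x)).trans (h x)

/-- Away from the origin the perturbation of the average is of order `ε φ`. -/
theorem UniformRegularity.exists_perturbation_bound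
    {f₁ f₂ : EuclideanSpace ℝ (Fin n) → ℝ → EuclideanSpace ℝ (Fin n)} {T L δ : ℝ}
    (h : UniformRegularity f₁ f₂ T L) (hδ : 0 < δ) {V φ : EuclideanSpace ℝ (Fin n) → ℝ}
    (hLyap : LyapunovAssumption f₁ f₂ T 0 0 δ V φ) :
    ∃ ε₁, 0 < ε₁ ∧ ∃ B, 0 ≤ B ∧ ∀ ε, 0 < ε → ε ≤ ε₁ → ∀ τ, 0 ≤ τ → ∀ y,
      δ ≤ ‖nearId f₁ f₂ T 0 0 ε y τ‖ →
      ‖transported f₁ f₂ T ε y τ - avgOf f₁ f₂ T (nearId f₁ f₂ T 0 0 ε y τ)‖ ≤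
        ε * (B * φ (nearId f₁ f₂ T 0 0 ε y τ)) := by
  obtain ⟨C, hC, hest⟩ := h.exists_nearId_estimates
  obtain ⟨α, hα, hαφ⟩ := hLyap.posDef.lower
  have hαδ := hα.pos hδ
  -- Outside the `δ`-ball `φ ≥ α(δ)`, so additive constants can be absorbed into `φ`.
  have hone : ∀ z, δ ≤ ‖z‖ → 1 ≤ (α δ)⁻¹ * φ z := fun z hz => by
    rw [le_inv_mul_iff₀ hαδ, mul_one]
    exact (hα.mono hδ.le hz).trans (hαφ z)
  rcases hLyap.growth with ⟨ε₀, hε₀, K, hK, hg⟩ | ⟨α₃, hα₃, hαx⟩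
  -- The bound `1 / (2 C)` makes `Φ - id` a contraction of ratio at most `1/2`, hence `Φ` injective.
  · refine ⟨min ε₀ (min 1 (1 / (2 * C))), by positivity, K * (1 + (α δ)⁻¹), by positivity,
      fun ε hε hle τ hτ y hy => ?_⟩
    have hε1 : ε ≤ 1 := hle.trans ((min_le_right _ _).trans (min_le_left _ _))
    have hCε : C * ε ≤ 1 / 2 := by
      have : ε ≤ 1 / (2 * C) := hle.trans ((min_le_right _ _).trans (min_le_right _ _))
      rw [le_div_iff₀ (by positivity)] at this
      linarith
    obtain ⟨-, hlip, -⟩ := hest ε hε hε1 τ hτ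
    have hinj : Function.Injective fun z => nearId f₁ f₂ T 0 0 ε z τ := by
      intro a b hab
      simp only at hab
      have h1 := hlip a b
      rw [hab, sub_sub_sub_cancel_left, norm_sub_rev] at h1
      have h2 := mul_le_mul_of_nonneg_right hCε (norm_nonneg (a - b))
      have h3 : ‖a - b‖ ≤ 0 := by linarith
      exact sub_eq_zero.1 (norm_le_zero_iff.1 h3)
    have h1 := hg _ hy τ hτ ε hε (hle.trans (min_le_left _ _))
    rw [remainder_nearId hinj, norm_smul, norm_inv, Real.norm_of_nonneg hε.le,
      inv_mul_le_iff₀ hε] at h1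
    refine h1.trans (mul_le_mul_of_nonneg_left ?_ hε.le)
    have := mul_le_mul_of_nonneg_left (hone _ hy) hK.le
    linarith
  · have hα₃δ := hα₃.pos hδ
    -- With `Cε ≤ 1/4` the error in `1 + |y|` is controlled by `1 + |z|`, which `φ(z)` dominates by
    -- the second growth alternative.
    refine ⟨min 1 (1 / (4 * C)), by positivity, C * (2 * (α δ)⁻¹ + 2 * (α₃ δ)⁻¹), by positivity,
      fun ε hε hle τ hτ y hy => ?_⟩
    have hε1 : ε ≤ 1 := hle.trans (min_le_left _ _)
    have hCε : C * ε ≤ 1 / 4 := by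
      have : ε ≤ 1 / (4 * C) := hle.trans (min_le_right _ _)
      rw [le_div_iff₀ (by positivity)] at this
      linarith
    obtain ⟨hid, -, hperturb⟩ := hest ε hε hε1 τ hτ
    set z := nearId f₁ f₂ T 0 0 ε y τ
    have hz : ‖z‖ ≤ (α₃ δ)⁻¹ * φ z := by
      rw [le_inv_mul_iff₀ hα₃δ]
      exact (mul_le_mul_of_nonneg_right (hα₃.mono hδ.le hy) (norm_nonneg _)).trans (hαx z)
    have hy1 : ‖y‖ ≤ ‖z‖ + ‖z - y‖ := by
      rw [norm_sub_rev]
      simpa using norm_add_le z (y - z)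
    have hy2 : C * ε * (1 + ‖y‖) ≤ 1 / 4 * (1 + ‖y‖) :=
      mul_le_mul_of_nonneg_right hCε (by positivity)
    have hy3 : 1 + ‖y‖ ≤ 2 * 1 + 2 * ‖z‖ := by linarith [hid y, norm_nonneg z]
    refine (hperturb y).trans ?_
    have := mul_le_mul_of_nonneg_left (hy3.trans (add_le_add (mul_le_mul_of_nonneg_left
      (hone z hy) zero_le_two) (mul_le_mul_of_nonneg_left hz zero_le_two)))
      (by positivity : 0 ≤ C * ε)
    linarith

theorem RegularityAssumption.continuousOn_oscField
    {f₁ f₂ : EuclideanSpace ℝ (Fin n) → ℝ → EuclideanSpace ℝ (Fin n)} {T : ℝ}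
    (h : RegularityAssumption f₁ f₂ 0 T) (ε : ℝ) :
    ContinuousOn (fun p : EuclideanSpace ℝ (Fin n) × ℝ => oscField f₁ f₂ ε p.1 p.2)
      (univ ×ˢ Ici 0) :=
  (h.continuousOn₁.const_smul ε⁻¹).add h.continuousOn₂

theorem UniformRegularity.lipschitz_oscField
    {f₁ f₂ : EuclideanSpace ℝ (Fin n) → ℝ → EuclideanSpace ℝ (Fin n)} {T L : ℝ}
    (h : UniformRegularity f₁ f₂ T L) {ε : ℝ} (hε : 0 < ε) {τ : ℝ} (hτ : 0 ≤ τ)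
    (x y : EuclideanSpace ℝ (Fin n)) :
    ‖oscField f₁ f₂ ε x τ - oscField f₁ f₂ ε y τ‖ ≤ (ε⁻¹ * L + L) * ‖x - y‖ := by
  have e : oscField f₁ f₂ ε x τ - oscField f₁ f₂ ε y τ =
      ε⁻¹ • (f₁ x τ - f₁ y τ) + (f₂ x τ - f₂ y τ) := by
    simp only [oscField]
    module
  rw [e]
  refine (norm_add_le _ _).trans ?_
  rw [norm_smul, norm_inv, Real.norm_of_nonneg hε.le]
  have h1 := mul_le_mul_of_nonneg_left (h.oscillating.lipschitz τ hτ x y) (inv_nonneg.2 hε.le)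
  linarith [h.lipschitz₂ τ hτ x y]

/-- The averaged decrease of `V` dominates a function of `V`, independently of the excluded
neighbourhood of the origin. -/
theorem exists_lyapunov_decay_rate
    {f₁ f₂ : EuclideanSpace ℝ (Fin n) → ℝ → EuclideanSpace ℝ (Fin n)} {T : ℝ}
    {V φ : EuclideanSpace ℝ (Fin n) → ℝ}
    (hLyap : ∀ δ, 0 < δ → LyapunovAssumption f₁ f₂ T 0 0 δ V φ) :
    ∃ ρ : ℝ → ℝ, Continuous ρ ∧ Monotone ρ ∧ ρ 0 = 0 ∧ (∀ v, 0 < v → 0 < ρ v) ∧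
      ∀ x, inner ℝ (gradient V x) (avgOf f₁ f₂ T x) ≤ -(2 * ρ (V x)) := by
  have h1 := hLyap 1 one_pos
  obtain ⟨α, hα, hαφ⟩ := h1.posDef.lower
  obtain ⟨α₁, α₂, hα₁, hα₂, hV⟩ := h1.bounds_V
  have hdec : ∀ δ, 0 < δ → ∃ c, 0 < c ∧ ∀ x, δ ≤ ‖x‖ →
      c * φ x ^ 2 ≤ -inner ℝ (gradient V x) (avgOf f₁ f₂ T x) / 2 := fun δ hδ => by
    obtain ⟨c, hc, hd⟩ := (hLyap δ hδ).decrease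
    refine ⟨c / 2, by positivity, fun x hx => ?_⟩
    have := hd x hx
    rw [avgField_zero_zero] at this
    linarith
  have hV0 : V 0 = 0 := by
    have := hV 0
    rw [norm_zero, hα₁.zero, hα₂.zero] at this
    exact le_antisymm this.2 this.1
  have hgrad : gradient V 0 = 0 := by
    obtain ⟨c₂, -, hc⟩ := h1.gradient_le
    have := hc 0
    rw [h1.posDef.zero, mul_zero] at this
    exact norm_le_zero_iff.1 this
  have hW0 : -inner ℝ (gradient V 0) (avgOf f₁ f₂ T 0) / 2 = (0 : ℝ) := by
    rw [hgrad, inner_zero_left, neg_zero, zero_div]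
  -- Only half of the averaged decrease enters `W`; the other half is reserved for the perturbation.
  -- `W` is nonnegative at `x ≠ 0` by the decrease condition with radius `|x|`.
  obtain ⟨ρ, hρc, hρm, hρ0, hρpos, hρ⟩ := exists_decay_rate (V := V)
    (W := fun x => -inner ℝ (gradient V x) (avgOf f₁ f₂ T x) / 2) (x₀ := 0) (fun x => by
      rcases eq_or_ne x 0 with rfl | hx
      · exact hW0.ge
      · obtain ⟨c, hc, hd⟩ := hdec ‖x‖ (norm_pos_iff.2 hx)
        exact le_trans (by positivity) (hd x le_rfl)) hV0 hW0 (fun v hv => by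
      -- Since `α₂ r ≤ v / 2`, points with `V x ≥ v` lie outside the ball of radius `r`, where the
      -- decrease is at least `c α(r)²`.
      obtain ⟨r, hr, hr'⟩ := hα₂.toIsClassK.exists_le (half_pos hv)
      obtain ⟨c, hc, hd⟩ := hdec r hr
      have hαr := hα.pos hr
      refine ⟨c * α r ^ 2, by positivity, fun x hx => ?_⟩
      have hrx : r ≤ ‖x‖ := by
        by_contra! hlt
        have := hα₂.toIsClassK.mono (norm_nonneg x) hlt.le
        linarith [(hV x).2]
      refine le_trans ?_ (hd x hrx)
      have := (hα.mono hr.le hrx).trans (hαφ x)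
      gcongr)
  exact ⟨ρ, hρc, hρm, hρ0, hρpos, fun x => by linarith [hρ x]⟩

theorem isUGpAS_of_lyapunov
    {f₁ f₂ : EuclideanSpace ℝ (Fin n) → ℝ → EuclideanSpace ℝ (Fin n)} {T : ℝ}
    (hreg : RegularityAssumption f₁ f₂ 0 T) {V φ : EuclideanSpace ℝ (Fin n) → ℝ}
    (hLyap : ∀ δ, 0 < δ → LyapunovAssumption f₁ f₂ T 0 0 δ V φ) :
    IsUGpAS (oscField f₁ f₂) := by
  obtain ⟨L, h⟩ := hreg.exists_uniformRegularity
  obtain ⟨C, hC, hest⟩ := h.exists_nearId_estimates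
  have hL1 := hLyap 1 one_pos
  obtain ⟨α₁, α₂, hα₁, hα₂, hV⟩ := hL1.bounds_V
  obtain ⟨ρ, hρc, hρm, hρ0, hρpos, hρ⟩ := exists_lyapunov_decay_rate hLyap
  -- The relation is `α₁(β/2) + t ρ(α₁(β/2)) = α₂(4r)`. The `1/2` reflects `|x| ≤ 2|z| + 2κ`, the
  -- `4` reflects `|z(0)| ≤ 4|x₀|` when `|x₀| ≥ κ`. Nothing here depends on `ν`.
  obtain ⟨β, hβ, hβle⟩ := exists_classKL_of_implicit (hα₁.comp_mul_left (half_pos one_pos))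
    (hα₂.comp_mul_left (c := 4) (by norm_num)) hρc hρm hρ0 hρpos
  refine ⟨β, hβ, fun ν hν => ?_⟩
  -- On the residual sublevel set `V ≤ α₂(δ)` this forces `|z| ≤ ν/8`, hence `|x| ≤ ν/4 + 2κ ≤ ν`.
  obtain ⟨δ, hδ, hδη⟩ := hα₂.toIsClassK.exists_le
    (hα₁.toIsClassK.pos (by positivity : 0 < ν / 8))
  have hLδ := hLyap δ hδ
  obtain ⟨ε₁, hε₁, B, hB, hperturb⟩ := h.exists_perturbation_bound hδ hLδ
  obtain ⟨c₁, hc₁, hdec⟩ := hLδ.decrease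
  obtain ⟨c₂, hc₂, hgrad⟩ := hLδ.gradient_le
  rw [avgField_zero_zero] at hdec
  -- The quotient with `c₁` keeps the perturbation below half of the decrease. With `κ = Cε`, the
  -- bound `1/4` compares `x` with `z`, `δ/3` handles initial points with `|x₀| < κ`, and `ν/4`
  -- gives `2κ ≤ ν/2`.
  refine ⟨min (min 1 ε₁) (min (c₁ / (2 * (c₂ * B + 1))) (min (1 / 4) (min (δ / 3) (ν / 4)) / C)),
    by positivity, fun ε hε hεlt x₀ τ₀ hτ₀ ts x τ hsol => ?_⟩
  obtain ⟨⟨hε1, hεε₁⟩, hεB, hεC⟩ : (ε ≤ 1 ∧ ε ≤ ε₁) ∧ ε ≤ c₁ / (2 * (c₂ * B + 1)) ∧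
      ε ≤ min (1 / 4) (min (δ / 3) (ν / 4)) / C := by
    simpa only [le_min_iff] using hεlt.le
  rw [le_div_iff₀ (by positivity)] at hεB
  rw [le_div_iff₀ hC, mul_comm, le_min_iff, le_min_iff] at hεC
  obtain ⟨hκ1, hκδ, hκν⟩ := hεC
  refine ⟨fun t ht => ?_, fun hmax => hmax.eq_top (hreg.continuousOn_oscField ε)
    (by have := h.const_nonneg; positivity) fun τ hτ => h.lipschitz_oscField hε hτ⟩
  set κ := C * ε with hκ
  have hκ0 : 0 < κ := by positivity
  set z : ℝ → EuclideanSpace ℝ (Fin n) := fun s => nearId f₁ f₂ T 0 0 ε (x s) (τ s) with hz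
  have hzx : ∀ s ∈ lifeSpan ts, ‖z s - x s‖ ≤ κ * (1 + ‖x s‖) := fun s hs =>
    (hest ε hε hε1 (τ s) (hsol.τ_nonneg s hs)).1 (x s)
  have hsub := Icc_subset_lifeSpan ht
  have hdecay := decay_of_deriv_le (u := fun s => V (z s))
    (u' := fun s => inner ℝ (gradient V (z s)) (transported f₁ f₂ T ε (x s) (τ s))) (ρ := ρ)
    (m := α₂ δ) ht.1 (fun s hs => by
      have h1 := h.hasDerivWithinAt_nearId_comp hs (fun r hr => hsol.τ_nonneg r (hsub hr))
        ((hsol.deriv_x s (hsub hs)).mono hsub) ((hsol.deriv_τ s (hsub hs)).mono hsub)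
      have h2 : HasGradientAt V (gradient V (z s)) (z s) :=
        (hL1.contDiff_V.differentiable (by norm_num) (z s)).hasGradientAt
      exact h2.hasFDerivAt.comp_hasDerivWithinAt s h1)
    (hα₂.toIsClassK.nonneg hδ.le) hρm hρpos (fun s hs hlt => by
      have hzδ : δ ≤ ‖z s‖ := by
        by_contra! hlt'
        have := hα₂.toIsClassK.mono (norm_nonneg (z s)) hlt'.le
        linarith [(hV (z s)).2]
      have h1 := hperturb ε hε hεε₁ (τ s) (hsol.τ_nonneg s (hsub hs)) (x s) hzδ
      have h2 := hdec (z s) hzδ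
      have h3 := hρ (z s)
      have h4 : inner ℝ (gradient V (z s)) (transported f₁ f₂ T ε (x s) (τ s)
          - avgOf f₁ f₂ T (z s)) ≤ c₂ * φ (z s) * (ε * (B * φ (z s))) :=
        (real_inner_le_norm _ _).trans (mul_le_mul (hgrad _) h1 (norm_nonneg _)
          (mul_nonneg hc₂.le (hLδ.posDef.nonneg _)))
      rw [inner_sub_right] at h4
      -- The perturbation is at most `c₁ φ² / 2`, so at least half of the averaged decrease
      -- survives, and that half dominates `ρ(V)`.
      have h5 := mul_le_mul_of_nonneg_right hεB (sq_nonneg (φ (z s)))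
      nlinarith [mul_nonneg hε.le (sq_nonneg (φ (z s)))])
  have hβ0 : 0 ≤ β ‖x₀‖ t := by
    refine hβle _ t 0 (norm_nonneg _) ht.1 le_rfl ?_
    rw [mul_zero, hα₁.zero, hρ0, mul_zero, add_zero]
    exact hα₂.toIsClassK.nonneg (by positivity)
  have hxz : ‖x t‖ ≤ 2 * ‖z t‖ + 2 * κ := by
    have h1 : ‖x t‖ ≤ ‖z t‖ + ‖z t - x t‖ := by
      rw [norm_sub_rev]
      simpa using norm_add_le (z t) (x t - z t)
    have h2 := hzx t ht
    have h3 := mul_le_mul_of_nonneg_right hκ1 (norm_nonneg (x t))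
    linarith [norm_nonneg (z t)]
  have hsmall : V (z t) ≤ α₂ δ → ‖x t‖ ≤ β ‖x₀‖ t + ν := fun hle => by
    have : ‖z t‖ ≤ ν / 8 := hα₁.toIsClassK.le_of_le (norm_nonneg _) (by positivity)
      ((hV _).1.trans (hle.trans hδη))
    linarith
  rcases hdecay with hle | hle
  · exact hsmall hle
  · have hVt : 0 ≤ V (z t) := (hα₁.toIsClassK.nonneg (norm_nonneg _)).trans (hV _).1
    have h0 := hzx 0 hsol.zero_mem
    rw [hsol.init_x] at h0
    have hz0 : ‖z 0‖ ≤ ‖x₀‖ + κ * (1 + ‖x₀‖) := by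
      have : ‖z 0‖ ≤ ‖z 0 - x₀‖ + ‖x₀‖ := by simpa using norm_add_le (z 0 - x₀) x₀
      linarith
    have h3 := mul_le_mul_of_nonneg_right hκ1 (norm_nonneg x₀)
    -- `Φ` need not fix the origin, so for `|x₀| < κ` the value `V(z(0))` is not controlled by
    -- `|x₀|`. In that case `|z(0)| ≤ 3κ ≤ δ`, and the solution stays in the residual sublevel set.
    rcases lt_or_ge ‖x₀‖ κ with hx₀ | hx₀
    · refine hsmall ?_
      have h1 : α₂ ‖z 0‖ ≤ α₂ δ := hα₂.toIsClassK.mono (norm_nonneg _) (by linarith)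
      have h2 : 0 ≤ t * ρ (V (z t)) := mul_nonneg ht.1 (hρ0 ▸ hρm hVt)
      linarith [(hV (z 0)).2]
    · have h1 : α₂ ‖z 0‖ ≤ α₂ (4 * ‖x₀‖) := hα₂.toIsClassK.mono (norm_nonneg _) (by linarith)
      have h2 : 2 * ‖z t‖ ≤ β ‖x₀‖ t := by
        refine hβle _ t _ (norm_nonneg _) ht.1 (by positivity) ?_
        rw [show (1 / 2 : ℝ) * (2 * ‖z t‖) = ‖z t‖ by ring]
        have h4 := (hV (z t)).1
        have h5 := mul_le_mul_of_nonneg_left (hρm h4) ht.1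
        linarith [(hV (z 0)).2]
      linarith

end OscAvg

end

/-! ### Specialization to the absent cut-off -/

open OscAvg
theorem corollary3 {n : ℕ}
    (f₁ f₂ : EuclideanSpace ℝ (Fin n) → ℝ → EuclideanSpace ℝ (Fin n)) (T : ℝ)
    (hreg : RegularityAssumption f₁ f₂ 0 T)
    (V φ : EuclideanSpace ℝ (Fin n) → ℝ)
    (hLyap : ∀ ϵ : ℝ, 0 < ϵ → ∀ δ₂ δ₃ : ℝ, AdmissibleDelta ϵ 0 δ₂ δ₃ →
      LyapunovAssumption f₁ f₂ T 0 δ₂ δ₃ V φ) :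
    IsUGpAS (oscField f₁ f₂) := by
  -- For `δ₁ = δ₂ = 0` the bump is identically `1`, and admissibility reduces to `δ₃ > 0`; any
  -- positive `ϵ`, here `1`, will do.
  exact isUGpAS_of_lyapunov hreg fun δ hδ =>
    hLyap 1 one_pos 0 δ ⟨le_rfl, by simp, by simpa using hδ⟩
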